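/- Let $m>0$, $\mu_p<m$, $\lambda\in\mathbb R$ and $n\ge 0$ an integer. For momenta $k=(p,p_\perp)$, $p>0$, put $\omega(k)=\frac{m^2+p^2+p_\perp^2}{2p}$ and $d\kappa(k)=\frac{dp\,dp_\perp}{(2\pi)^2\,2p}$. Let $\mathcal F^{(n)}$ be the Hilbert space of symmetric functions in $L^2$ of $n$ momenta with respect to $\kappa^{\otimes n}$ (with $\mathcal F^{(0)}=\mathbb C$), and let $H_0$ be multiplication by $\sum_i\omega(k_i)$. For $\operatorname{Re}E<nm+\mu_p$ define on $\mathcal F^{(n)}$ $$K(E)=(H_0-E+\mu_p)+\lambda^2\int\Big(\frac1{\omega(k)-\mu_p}-\frac1{H_0-E+\omega(k)}\Big)d\kappa(k),$$ $$(U(E)\psi)(k_1,\dots,k_n)=\lambda^2\sum_{i=1}^n\int\frac{\psi(k_1,\dots,k_{i-1},k,k_{i+1},\dots,k_n)}{\sum_j\omega(k_j)-E+\omega(k)}\,d\kappa(k),$$ each on its maximal domain; $U(E)$ is the $n$-boson form of $\lambda^2\iint\frac{dp\,dp_\perp}{(2\pi)^2}\frac{dq\,dq_\perp}{(2\pi)^2}\frac{1}{2\sqrt{pq}}\,a^\dagger(q,q_\perp)\frac1{H_0-E+\omega(p,p_\perp)+\omega(q,q_\perp)}a(p,p_\perp)$.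 The principal operator is $\Phi(E)=K(E)-U(E)$ (on the intersection of the domains). 1. For every real $E<m(n-1)+\mu_p$ with $$\frac{\lambda^2\pi n}{2\,(m(n-1)+\mu_p-E)}<1,$$ the operator $K(E)^{-1/2}U(E)K(E)^{-1/2}$ is everywhere defined and bounded on $\mathcal F^{(n)}$ with $\|K(E)^{-1/2}U(E)K(E)^{-1/2}\|<1$, and $\Phi(E)$ is a bijection of its domain onto $\mathcal F^{(n)}$ with bounded inverse. 2. Let $(\phi^{(+)}f)(k_1,\dots,k_n)=\sqrt{n+1}\int f(k,k_1,\dots,k_n)\,d\kappa(k)$ and $(\phi^{(-)}g)(k_1,\dots,k_{n+1})=\frac1{\sqrt{n+1}}\sum_i g(k_1,\dots,\widehat{k_i},\dots,k_{n+1})$, and write $a=H_0-E$ on $\mathcal F^{(n+1)}$, $b=\lambda\phi^{(+)}$, $b^\dagger=\lambda\phi^{(-)}$ (only the products $ba^{-1}$ and $a^{-1}b^\dagger$, which are bounded, are used). There is exactly one self-adjoint operator $H$ on $\mathcal F^{(n+1)}\oplus\mathcal F^{(n)}$ (the Hamiltonian of the model in this sector) such that, for every $E\in\mathbb C$ with $\operatorname{Re}E<nm+\mu_p$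 at which $\Phi(E)$ has a bounded inverse, $E$ is in the resolvent set of $H$ and $$(H-E)^{-1}=\begin{pmatrix}a^{-1}+a^{-1}b^\dagger\Phi(E)^{-1}ba^{-1}&-a^{-1}b^\dagger\Phi(E)^{-1}\\-\Phi(E)^{-1}ba^{-1}&\Phi(E)^{-1}\end{pmatrix}.$$ Its spectrum is nonempty and bounded below, and the ground state energy $E_{gr}=\inf\sigma(H)$ satisfies $$E_{gr}\ \ge\ m(n-1)+\mu_p-\frac{\lambda^2\pi n}{2}.$$ -/

import Mathlib

open MeasureTheory

noncomputable section

namespace LightFrontLee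

/-! ### Momentum space and the bosonic Fock sectors -/

/-- The invariant measure `dp dp⊥ / ((2π)² 2p)` on momenta `k = (p, p⊥)` with `p > 0`. -/
def momentumMeasure : Measure (ℝ × ℝ) :=
  (volume.restrict {k : ℝ × ℝ | 0 < k.1}).withDensity
    fun k => ENNReal.ofReal (1 / ((2 * Real.pi) ^ 2 * (2 * k.1)))

instance : SigmaFinite momentumMeasure := by
  unfold momentumMeasure; infer_instance

/-- The product measure `∏ᵢ dpᵢ dpᵢ⊥ / ((2π)² 2pᵢ)` on `n`-particle momenta. -/
def nMeasure (n : ℕ) : Measure (Fin n → ℝ × ℝ) :=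
  Measure.pi fun _ => momentumMeasure

instance (n : ℕ) : SigmaFinite (nMeasure n) := by
  unfold nMeasure; infer_instance

theorem measurePreserving_insertNth (n : ℕ) (i : Fin (n + 1)) :
    MeasurePreserving (fun q : (ℝ × ℝ) × (Fin n → ℝ × ℝ) =>
      (i.insertNth q.1 q.2 : Fin (n + 1) → ℝ × ℝ))
      (momentumMeasure.prod (nMeasure n)) (nMeasure (n + 1)) :=
  (measurePreserving_piFinSuccAbove (fun _ : Fin (n + 1) => momentumMeasure) i).symm

theorem measurePreserving_perm (n : ℕ) (σ : Equiv.Perm (Fin n)) :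
    MeasurePreserving (fun k : Fin n → ℝ × ℝ => k ∘ σ) (nMeasure n) (nMeasure n) := by
  exact measurePreserving_arrowCongr' (fun _ : Fin n => momentumMeasure)
    (fun _ : Fin n => momentumMeasure) σ.symm (MeasurableEquiv.refl (ℝ × ℝ))
    (fun _ => MeasurePreserving.id _)

/-- For a.e. `k`, an a.e. property holds at `(p, k)` for a.e. `p`. -/
theorem ae_cons {n : ℕ} {P : (Fin (n + 1) → ℝ × ℝ) → Prop} (h : ∀ᵐ k ∂nMeasure (n + 1), P k) :
    ∀ᵐ k ∂nMeasure n, ∀ᵐ p ∂momentumMeasure, P (Fin.cons p k) := by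
  have h1 := (measurePreserving_insertNth n 0).quasiMeasurePreserving.ae h
  have h2 := (Measure.measurePreserving_swap
    (μ := nMeasure n) (ν := momentumMeasure)).quasiMeasurePreserving.ae h1
  filter_upwards [Measure.ae_ae_of_ae_prod h2] with k hk
  simpa [Fin.insertNth_zero'] using hk

/-- Forgetting one momentum is compatible with a.e. statements. -/
theorem ae_removeNth {n : ℕ} (i : Fin (n + 1)) {P : (Fin n → ℝ × ℝ) → Prop}
    (h : ∀ᵐ k ∂nMeasure n, P k) : ∀ᵐ k ∂nMeasure (n + 1), P (i.removeNth k) := by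
  have h1 : ∀ᵐ q ∂(momentumMeasure.prod (nMeasure n)), P q.2 :=
    Measure.quasiMeasurePreserving_snd.ae h
  have h2 := (measurePreserving_piFinSuccAbove
    (fun _ : Fin (n + 1) => momentumMeasure) i).quasiMeasurePreserving.ae h1
  exact h2

/-- For a.e. `k`, an a.e. property still holds when one momentum is replaced by a.e. `p`. -/
theorem ae_update {n : ℕ} (i : Fin n) {P : (Fin n → ℝ × ℝ) → Prop}
    (h : ∀ᵐ k ∂nMeasure n, P k) :
    ∀ᵐ k ∂nMeasure n, ∀ᵐ p ∂momentumMeasure, P (Function.update k i p) := by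
  cases n with
  | zero => exact i.elim0
  | succ n =>
    have h1 := (measurePreserving_insertNth n i).quasiMeasurePreserving.ae h
    have h2 := (Measure.measurePreserving_swap
      (μ := nMeasure n) (ν := momentumMeasure)).quasiMeasurePreserving.ae h1
    filter_upwards [ae_removeNth i (Measure.ae_ae_of_ae_prod h2)] with k hk
    filter_upwards [hk] with p hp
    simpa [Fin.insertNth_removeNth] using hp

/-- The symmetric square integrable functions of `n` momenta, with the invariant norm
`∫ |ψ|² ∏ᵢ dpᵢ dpᵢ⊥ / ((2π)² 2pᵢ)`. -/
def symmetricSubspace (n : ℕ) : Submodule ℂ (Lp ℂ 2 (nMeasure n)) where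
  carrier := {ψ | ∀ σ : Equiv.Perm (Fin n), (fun k => ψ (k ∘ σ)) =ᵐ[nMeasure n] ψ}
  add_mem' {ψ χ} hψ hχ σ := by
    have h1 := Lp.coeFn_add ψ χ
    have h2 := (measurePreserving_perm n σ).quasiMeasurePreserving.ae h1
    filter_upwards [h1, h2, hψ σ, hχ σ] with k a b c d
    simp only [Pi.add_apply] at a b
    rw [a, b, c, d]
  zero_mem' σ := by
    have h1 := Lp.coeFn_zero ℂ 2 (nMeasure n)
    have h2 := (measurePreserving_perm n σ).quasiMeasurePreserving.ae h1
    filter_upwards [h1, h2] with k a b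
    rw [a, b]; rfl
  smul_mem' c ψ hψ σ := by
    have h1 := Lp.coeFn_smul c ψ
    have h2 := (measurePreserving_perm n σ).quasiMeasurePreserving.ae h1
    filter_upwards [h1, h2, hψ σ] with k a b d
    simp only [Pi.smul_apply] at a b
    rw [a, b, d]

/-- The `n`-boson sector of the Fock space. -/
abbrev Fock (n : ℕ) : Type := symmetricSubspace n

theorem isClosed_symmetricSubspace (n : ℕ) :
    IsClosed (symmetricSubspace n : Set (Lp ℂ 2 (nMeasure n))) := by
  have : (symmetricSubspace n : Set (Lp ℂ 2 (nMeasure n))) =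
      ⋂ σ : Equiv.Perm (Fin n),
        {ψ | Lp.compMeasurePreserving _ (measurePreserving_perm n σ) ψ = ψ} := by
    ext ψ
    simp only [Set.mem_iInter, Set.mem_ofPred_eq]
    refine forall_congr' fun σ => ?_
    have h := Lp.coeFn_compMeasurePreserving ψ (measurePreserving_perm n σ)
    constructor
    · intro hψ
      exact Lp.ext (h.trans hψ)
    · intro hψ
      rw [hψ] at h
      exact h.symm
  rw [this]
  exact isClosed_iInter fun σ => isClosed_eq
    (Lp.isometry_compMeasurePreserving (measurePreserving_perm n σ)).continuous continuous_id

instance (n : ℕ) : CompleteSpace (Fock n) :=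
  (isClosed_symmetricSubspace n).completeSpace_coe

/-- The value of a state at the momenta `k` (a representative, determined almost everywhere). -/
def amp {n : ℕ} (ψ : Fock n) : (Fin n → ℝ × ℝ) → ℂ := (ψ : Lp ℂ 2 (nMeasure n))

theorem amp_zero (n : ℕ) : amp (0 : Fock n) =ᵐ[nMeasure n] 0 :=
  Lp.coeFn_zero ℂ 2 (nMeasure n)

theorem amp_add {n : ℕ} (ψ χ : Fock n) : amp (ψ + χ) =ᵐ[nMeasure n] amp ψ + amp χ :=
  Lp.coeFn_add (ψ : Lp ℂ 2 (nMeasure n)) χ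

theorem amp_smul {n : ℕ} (c : ℂ) (ψ : Fock n) : amp (c • ψ) =ᵐ[nMeasure n] c • amp ψ :=
  Lp.coeFn_smul c (ψ : Lp ℂ 2 (nMeasure n))

theorem amp_ext {n : ℕ} {ψ χ : Fock n} (h : amp ψ =ᵐ[nMeasure n] amp χ) : ψ = χ :=
  Subtype.ext (Lp.ext h)

/-! ### Unbounded operators -/

section PartialOperators

variable {V W X : Type*} [AddCommGroup V] [Module ℂ V] [AddCommGroup W] [Module ℂ W]
  [AddCommGroup X] [Module ℂ X]

/-- Composition `B ∘ A` of unbounded operators on its natural domain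
`{x ∈ D(A) | A x ∈ D(B)}`. -/
def pcomp (B : W →ₗ.[ℂ] X) (A : V →ₗ.[ℂ] W) : V →ₗ.[ℂ] X :=
  Submodule.toLinearPMap
    { carrier := {z | ∃ y, (z.1, y) ∈ A.graph ∧ (y, z.2) ∈ B.graph}
      add_mem' := by
        rintro z z' ⟨y, h1, h2⟩ ⟨y', h1', h2'⟩
        exact ⟨y + y', A.graph.add_mem h1 h1', B.graph.add_mem h2 h2'⟩
      zero_mem' := ⟨0, A.graph.zero_mem, B.graph.zero_mem⟩
      smul_mem' := by
        rintro c z ⟨y, h1, h2⟩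
        exact ⟨c • y, A.graph.smul_mem c h1, B.graph.smul_mem c h2⟩ }

theorem mem_graph_pcomp (B : W →ₗ.[ℂ] X) (A : V →ₗ.[ℂ] W) (x : V) (z : X) :
    (x, z) ∈ (pcomp B A).graph ↔ ∃ y, (x, y) ∈ A.graph ∧ (y, z) ∈ B.graph := by
  rw [pcomp, Submodule.toLinearPMap_graph_eq]
  · rfl
  · rintro ⟨x, z⟩ ⟨y, h1, h2⟩ h0
    simp only at h0 h1 h2
    subst h0
    have : y = 0 := LinearPMap.graph_fst_eq_zero_snd A h1 rfl
    subst this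
    exact LinearPMap.graph_fst_eq_zero_snd B h2 rfl

/-- `A - E` on the domain of `A`. -/
def shift (A : V →ₗ.[ℂ] V) (E : ℂ) : V →ₗ.[ℂ] V :=
  A - (E • (LinearMap.id : V →ₗ[ℂ] V)).toPMap ⊤

end PartialOperators

section BoundedInverse

variable {V : Type*} [NormedAddCommGroup V] [NormedSpace ℂ V]

/-- `A` maps its domain bijectively onto the whole space, and the bounded operator `T` is the
inverse. -/
def HasBoundedInverse (A : V →ₗ.[ℂ] V) (T : V →L[ℂ] V) : Prop :=
  ∀ x y : V, (x, y) ∈ A.graph ↔ T y = x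

/-- The real points of the spectrum of `A`. -/
def realSpectrum (A : V →ₗ.[ℂ] V) : Set ℝ :=
  {E | ¬ ∃ R : V →L[ℂ] V, HasBoundedInverse (shift A (E : ℂ)) R}

/-- The ground state energy of a self-adjoint operator: the bottom of its spectrum. -/
def groundStateEnergy (A : V →ₗ.[ℂ] V) : ℝ := sInf (realSpectrum A)

end BoundedInverse

/-! ### The operators of the model

Throughout, `m` is the boson mass, `mu` the physical energy `μ_p` of the down state, and `lam` the
coupling constant. -/

/-- The dispersion relation `ω(p, p⊥) = (m² + p² + p⊥²) / (2p)`. -/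
def omega (m : ℝ) (k : ℝ × ℝ) : ℝ := (m ^ 2 + k.1 ^ 2 + k.2 ^ 2) / (2 * k.1)

/-- The free energy: `H₀` is multiplication by `∑ᵢ ω(kᵢ)`. -/
def freeEnergy (m : ℝ) {n : ℕ} (k : Fin n → ℝ × ℝ) : ℝ := ∑ i, omega m (k i)

/-- The function `s(H₀)` of the free Hamiltonian: multiplication by `s (∑ᵢ ω(kᵢ))` on its
maximal domain. -/
def funH0 (m : ℝ) (n : ℕ) (s : ℝ → ℂ) : Fock n →ₗ.[ℂ] Fock n :=
  Submodule.toLinearPMap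
    { carrier := {z | amp z.2 =ᵐ[nMeasure n] fun k => s (freeEnergy m k) * amp z.1 k}
      add_mem' := by
        intro z z' h h'
        filter_upwards [h, h', amp_add z.1 z'.1, amp_add z.2 z'.2] with k a b c d
        simp only [Prod.fst_add, Prod.snd_add]
        rw [d, c, Pi.add_apply, Pi.add_apply, a, b, mul_add]
      zero_mem' := by
        filter_upwards [amp_zero n] with k a
        simp only [Prod.fst_zero, Prod.snd_zero]
        rw [a]; simp
      smul_mem' := by
        intro c z h
        filter_upwards [h, amp_smul c z.1, amp_smul c z.2] with k a b d
        simp only [Prod.smul_fst, Prod.smul_snd]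
        rw [d, b, Pi.smul_apply, Pi.smul_apply, a, smul_eq_mul, smul_eq_mul]; ring }

theorem mem_graph_funH0 (m : ℝ) (n : ℕ) (s : ℝ → ℂ) (ψ χ : Fock n) :
    (ψ, χ) ∈ (funH0 m n s).graph ↔
      amp χ =ᵐ[nMeasure n] fun k => s (freeEnergy m k) * amp ψ k := by
  rw [funH0, Submodule.toLinearPMap_graph_eq]
  · rfl
  · rintro ⟨x, z⟩ h h0
    simp only at h0
    subst h0
    refine amp_ext ?_
    filter_upwards [(h : amp z =ᵐ[nMeasure n] _), amp_zero n] with k a b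
    rw [a, b]; simp

/-- The function `h ↦ (h - E + μ_p) + λ² ∫ (dp dp⊥ / (2π)²) (1/2p) (1/(ω - μ_p) - 1/(h - E + ω))`. -/
def kineticSymbol (m mu lam : ℝ) (E : ℂ) (h : ℝ) : ℂ :=
  ((h : ℂ) - E + mu) + (lam : ℂ) ^ 2 *
    ∫ k, (1 / ((omega m k : ℂ) - mu) - 1 / ((h : ℂ) - E + omega m k)) ∂momentumMeasure

/-- The kinetic part `K(E) = (H₀ - E + μ_p) + K₁(E)`. -/
def kineticOp (m mu lam : ℝ) (n : ℕ) (E : ℂ) : Fock n →ₗ.[ℂ] Fock n :=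
  funH0 m n (kineticSymbol m mu lam E)

/-- `K(E)^{-1/2}`. -/
def kineticInvSqrt (m mu lam : ℝ) (n : ℕ) (E : ℂ) : Fock n →ₗ.[ℂ] Fock n :=
  funH0 m n fun h => kineticSymbol m mu lam E h ^ (-(1 / 2) : ℂ)

/-- The integrand of the potential in the source momentum `p`, for the `i`-th boson. -/
def potentialIntegrand (m : ℝ) {n : ℕ} (E : ℂ) (ψ : Fock n) (k : Fin n → ℝ × ℝ) (i : Fin n)
    (p : ℝ × ℝ) : ℂ :=
  amp ψ (Function.update k i p) / ((freeEnergy m k : ℂ) - E + omega m p)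

/-- The potential
`U(E) = λ² ∫∫ (dp dp⊥ / (2π)²) (dq dq⊥ / (2π)²) (1 / (2√(pq)))
  a†(q, q⊥) (H₀ - E + ω(p, p⊥) + ω(q, q⊥))⁻¹ a(p, p⊥)`
in the `n`-boson sector, on its maximal domain. It replaces in turn each momentum `kᵢ`
(the created `q`) by the annihilated `p`; the operator `H₀` in the middle acts on the other `n - 1`
bosons, so that the denominator is `∑ⱼ ω(kⱼ) - E + ω(p)`. The factors `1 / √(2p)`, `1 / √(2q)` are
absorbed by the invariant normalization of the wave functions. -/
def potentialOp (m lam : ℝ) (n : ℕ) (E : ℂ) : Fock n →ₗ.[ℂ] Fock n :=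
  Submodule.toLinearPMap
    { carrier := {z |
        (∀ᵐ k ∂nMeasure n, ∀ i, Integrable (potentialIntegrand m E z.1 k i) momentumMeasure) ∧
        amp z.2 =ᵐ[nMeasure n] fun k =>
          (lam : ℂ) ^ 2 * ∑ i, ∫ p, potentialIntegrand m E z.1 k i p ∂momentumMeasure}
      add_mem' := by
        rintro z z' ⟨h1, h2⟩ ⟨h1', h2'⟩
        have key : ∀ᵐ k ∂nMeasure n, ∀ i, potentialIntegrand m E (z + z').1 k i
            =ᵐ[momentumMeasure]
            potentialIntegrand m E z.1 k i + potentialIntegrand m E z'.1 k i := by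
          refine ae_all_iff.2 fun i => ?_
          filter_upwards [ae_update i (amp_add z.1 z'.1)] with k hk
          filter_upwards [hk] with p hp
          simp only [potentialIntegrand, Prod.fst_add, Pi.add_apply]
          rw [hp, Pi.add_apply, add_div]
        constructor
        · filter_upwards [h1, h1', key] with k a b c i
          exact ((a i).add (b i)).congr (c i).symm
        · filter_upwards [h1, h1', key, h2, h2', amp_add z.2 z'.2] with k a b c d e f
          simp only [Prod.snd_add]
          rw [f, Pi.add_apply, d, e, ← mul_add, ← Finset.sum_add_distrib]
          congr 1
          refine Finset.sum_congr rfl fun i _ => ?_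
          rw [integral_congr_ae (c i), ← integral_add (a i) (b i)]
          rfl
      zero_mem' := by
        have key : ∀ᵐ k ∂nMeasure n, ∀ i,
            potentialIntegrand m E (0 : Fock n × Fock n).1 k i =ᵐ[momentumMeasure] 0 := by
          refine ae_all_iff.2 fun i => ?_
          filter_upwards [ae_update i (amp_zero n)] with k hk
          filter_upwards [hk] with p hp
          simp only [potentialIntegrand, Prod.fst_zero]
          rw [hp]; simp
        constructor
        · filter_upwards [key] with k c i
          exact (integrable_zero _ _ _).congr (c i).symm
        · filter_upwards [key, amp_zero n] with k c d
          simp only [Prod.snd_zero]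
          rw [d, Finset.sum_eq_zero fun i _ => by rw [integral_congr_ae (c i)]; simp]
          simp
      smul_mem' := by
        rintro c z ⟨h1, h2⟩
        have key : ∀ᵐ k ∂nMeasure n, ∀ i, potentialIntegrand m E (c • z).1 k i
            =ᵐ[momentumMeasure] c • potentialIntegrand m E z.1 k i := by
          refine ae_all_iff.2 fun i => ?_
          filter_upwards [ae_update i (amp_smul c z.1)] with k hk
          filter_upwards [hk] with p hp
          simp only [potentialIntegrand, Prod.smul_fst, Pi.smul_apply]
          rw [hp, Pi.smul_apply, smul_eq_mul, smul_eq_mul, mul_div_assoc]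
        constructor
        · filter_upwards [h1, key] with k a b i
          exact ((a i).smul c).congr (b i).symm
        · filter_upwards [h1, key, h2, amp_smul c z.2] with k a b d e
          simp only [Prod.smul_snd]
          rw [e, Pi.smul_apply, d, smul_eq_mul, mul_left_comm, Finset.mul_sum]
          congr 1
          refine Finset.sum_congr rfl fun i _ => ?_
          rw [integral_congr_ae (b i), ← smul_eq_mul, ← integral_smul]
          rfl }

theorem mem_graph_potentialOp (m lam : ℝ) (n : ℕ) (E : ℂ) (ψ χ : Fock n) :
    (ψ, χ) ∈ (potentialOp m lam n E).graph ↔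
      (∀ᵐ k ∂nMeasure n, ∀ i, Integrable (potentialIntegrand m E ψ k i) momentumMeasure) ∧
      amp χ =ᵐ[nMeasure n] fun k =>
        (lam : ℂ) ^ 2 * ∑ i, ∫ p, potentialIntegrand m E ψ k i p ∂momentumMeasure := by
  rw [potentialOp, Submodule.toLinearPMap_graph_eq]
  · rfl
  · rintro ⟨x, z⟩ ⟨-, h⟩ h0
    simp only at h0 h
    subst h0
    refine amp_ext ?_
    have key : ∀ᵐ k ∂nMeasure n, ∀ i,
        potentialIntegrand m E (0 : Fock n) k i =ᵐ[momentumMeasure] 0 := by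
      refine ae_all_iff.2 fun i => ?_
      filter_upwards [ae_update i (amp_zero n)] with k hk
      filter_upwards [hk] with p hp
      simp only [potentialIntegrand]
      rw [hp]; simp
    filter_upwards [h, key, amp_zero n] with k a c d
    rw [a, d, Finset.sum_eq_zero fun i _ => by rw [integral_congr_ae (c i)]; simp]
    simp

/-- `K(E)^{-1/2} U(E) K(E)^{-1/2}` on its natural domain. -/
def relativePotential (m mu lam : ℝ) (n : ℕ) (E : ℂ) : Fock n →ₗ.[ℂ] Fock n :=
  pcomp (kineticInvSqrt m mu lam n E)
    (pcomp (potentialOp m lam n E) (kineticInvSqrt m mu lam n E))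

/-- The renormalized principal operator `Φ(E) = K(E) - U(E)`. -/
def principalOp (m mu lam : ℝ) (n : ℕ) (E : ℂ) : Fock n →ₗ.[ℂ] Fock n :=
  kineticOp m mu lam n E - potentialOp m lam n E

/-! ### The resolvent formula and the Hamiltonian

With `a = H₀ - E` on `n + 1` bosons and `b = λ φ⁽⁺⁾(0)`, where
`(φ⁽⁺⁾(0) f)(k) = √(n+1) ∫ f(p, k) dp dp⊥ / ((2π)² 2p)` and
`(φ⁽⁻⁾(0) g)(k) = (n+1)^{-1/2} ∑ᵢ g(k without kᵢ)`. -/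

/-- `b a⁻¹ = λ φ⁽⁺⁾(0) (H₀ - E)⁻¹`, from `n + 1` to `n` bosons. -/
def IsBAInv (m lam : ℝ) (n : ℕ) (E : ℂ) (f : Fock (n + 1)) (w : Fock n) : Prop :=
  (∀ᵐ k ∂nMeasure n, Integrable (fun p : ℝ × ℝ =>
      amp f (Fin.cons p k) / ((freeEnergy m (Fin.cons p k : Fin (n + 1) → ℝ × ℝ) : ℂ) - E))
      momentumMeasure) ∧
  amp w =ᵐ[nMeasure n] fun k => (lam : ℂ) * ((Real.sqrt (n + 1) : ℝ) : ℂ) * ∫ p : ℝ × ℝ,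
      amp f (Fin.cons p k) / ((freeEnergy m (Fin.cons p k : Fin (n + 1) → ℝ × ℝ) : ℂ) - E)
      ∂momentumMeasure

/-- `a⁻¹ b† = (H₀ - E)⁻¹ λ φ⁽⁻⁾(0)`, from `n` to `n + 1` bosons. -/
def IsAInvBdag (m lam : ℝ) (n : ℕ) (E : ℂ) (g : Fock n) (u : Fock (n + 1)) : Prop :=
  amp u =ᵐ[nMeasure (n + 1)] fun k =>
    ((freeEnergy m k : ℂ) - E)⁻¹ *
      ((lam : ℂ) * (((Real.sqrt (n + 1))⁻¹ : ℝ) : ℂ) *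
        ∑ i : Fin (n + 1), amp g (i.removeNth k))

/-- The Hilbert space of the sector: `n + 1` bosons with the up state, and `n` bosons with the
down state. -/
abbrev Sector (n : ℕ) : Type := WithLp 2 (Fock (n + 1) × Fock n)

/-- `R` is the bounded operator with the block form `[α γ; β δ]`, where
`α = a⁻¹ + a⁻¹ b† Φ⁻¹ b a⁻¹`, `β = -Φ⁻¹ b a⁻¹`, `γ = -a⁻¹ b† Φ⁻¹`, `δ = Φ⁻¹`, and `Φinv = Φ(E)⁻¹`. -/
def IsBlockResolvent (m lam : ℝ) (n : ℕ) (E : ℂ) (Φinv : Fock n →L[ℂ] Fock n)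
    (R : Sector n →L[ℂ] Sector n) : Prop :=
  ∀ (f : Fock (n + 1)) (g : Fock n),
    ∃ (af : Fock (n + 1)) (bf : Fock n) (cf cg : Fock (n + 1)),
      (f, af) ∈ (funH0 m (n + 1) fun h => ((h : ℂ) - E)⁻¹).graph ∧
      IsBAInv m lam n E f bf ∧
      IsAInvBdag m lam n E (Φinv bf) cf ∧
      IsAInvBdag m lam n E (Φinv g) cg ∧
      R (WithLp.toLp 2 (f, g)) = WithLp.toLp 2 (af + cf - cg, -Φinv bf + Φinv g)

/-- `H` is the Hamiltonian of the model in the sector with `n` or `n + 1` bosons: the self-adjoint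
operator whose resolvent `(H - E)⁻¹` is given by the block formula at every `E` with
`Re E < n m + μ_p` at which `Φ(E)` has a bounded inverse. -/
structure IsHamiltonian (m mu lam : ℝ) (n : ℕ) (H : Sector n →ₗ.[ℂ] Sector n) : Prop where
  selfAdjoint : IsSelfAdjoint H
  resolvent : ∀ E : ℂ, E.re < n * m + mu → ∀ Φinv : Fock n →L[ℂ] Fock n,
    HasBoundedInverse (principalOp m mu lam n E) Φinv →
      ∃ R : Sector n →L[ℂ] Sector n,
        IsBlockResolvent m lam n E Φinv R ∧ HasBoundedInverse (shift H E) R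

end LightFrontLee

end

/-!
Put `c = m (n - 1) + μ - E`. The operator `K^(-1/2) U K^(-1/2)` is a sum of `n` terms, each with a
kernel that replaces one momentum `x` by another `y`. As `ω ≥ m > μ`, the denominator of `U` is at
least the mean of `ω(x) + c` and `ω(y) + c`, and the factors `K^(-1/2)` contribute at most
`((ω(x) + c) (ω(y) + c))^(-1/2)`. By AM-GM the kernel is dominated by
`λ² / ((ω(x) + c) (ω(y) + c))`, and since `∫ (ω + c)⁻² dκ ≤ 1 / (4πc)`, its Hilbert–Schmidt norm is
at most `λ² / (4πc)`. Hence `‖K^(-1/2) U K^(-1/2)‖ ≤ nλ² / (4πc)`, and where this is below `1` a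
Neumann series inverts `Φ = K^(1/2) (1 - K^(-1/2) U K^(-1/2)) K^(1/2)`.

By the canonical commutation relations, `b a(E)⁻¹ a(F)⁻¹ b†` has a diagonal part, equal up to the
free term to the divided difference of `K`, and an exchange part, the divided difference of `U`:
`Φ(E) = Φ(F) - (E - F) (1 + b a(E)⁻¹ a(F)⁻¹ b†)`. So the block operators `R(E)` satisfy the
resolvent identity, and a single injective self-adjoint `R(E₀)` with `E₀` real determines the
Hamiltonian `H = R(E₀)⁻¹ + E₀`, of which every other `R(E)` is a resolvent. Its spectrum is nonempty
because a nonzero self-adjoint `R(E₀)` has a nonzero real spectral value.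
-/

noncomputable section

namespace LightFrontLee

/-! ### Graphs of unbounded operators -/

section Graph

variable {V : Type*} [AddCommGroup V] [Module ℂ V]

theorem mem_graph_toPMap_top (L : V →ₗ[ℂ] V) (x y : V) :
    (x, y) ∈ (L.toPMap ⊤).graph ↔ L x = y := by
  rw [LinearPMap.mem_graph_iff]
  exact ⟨by rintro ⟨z, rfl, h⟩; exact h, fun h => ⟨⟨x, trivial⟩, rfl, h⟩⟩

theorem mem_graph_sub (A B : V →ₗ.[ℂ] V) (x y : V) :
    (x, y) ∈ (A - B).graph ↔ ∃ u v, (x, u) ∈ A.graph ∧ (x, v) ∈ B.graph ∧ y = u - v := by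
  simp only [LinearPMap.mem_graph_iff]
  constructor
  · rintro ⟨z, rfl, h⟩
    refine ⟨_, _, ⟨⟨z.1, z.2.1⟩, rfl, rfl⟩, ⟨⟨z.1, z.2.2⟩, rfl, rfl⟩, ?_⟩
    rw [← h, LinearPMap.sub_apply]
  · rintro ⟨u, v, ⟨a, rfl, ha⟩, ⟨b, hb, hb'⟩, rfl⟩
    have hab : b = ⟨a.1, hb ▸ b.2⟩ := Subtype.ext hb
    refine ⟨⟨a.1, a.2, hb ▸ b.2⟩, rfl, ?_⟩
    rw [← ha, ← hb', congrArg B hab]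
    exact LinearPMap.sub_apply _ _ _

theorem mem_graph_shift (A : V →ₗ.[ℂ] V) (E : ℂ) (x y : V) :
    (x, y) ∈ (shift A E).graph ↔ (x, y + E • x) ∈ A.graph := by
  simp only [shift, mem_graph_sub, mem_graph_toPMap_top, LinearMap.smul_apply, LinearMap.id_apply]
  constructor
  · rintro ⟨u, _, hu, rfl, rfl⟩
    rwa [sub_add_cancel]
  · exact fun h => ⟨_, _, h, rfl, (add_sub_cancel_right y (E • x)).symm⟩

end Graph

/-! ### Resolvents -/

section Resolvent

variable {V : Type*} [NormedAddCommGroup V] [NormedSpace ℂ V]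

theorem HasBoundedInverse.injective {A : V →ₗ.[ℂ] V} {T : V →L[ℂ] V} (h : HasBoundedInverse A T) :
    Function.Injective T := by
  intro y y' hy
  exact LinearPMap.mem_graph_snd_inj A ((h _ y).2 rfl) ((h _ y').2 hy.symm) rfl

theorem HasBoundedInverse.mem_graph_iff {H : V →ₗ.[ℂ] V} {E : ℂ} {R : V →L[ℂ] V}
    (h : HasBoundedInverse (shift H E) R) (x y : V) :
    (x, y) ∈ H.graph ↔ R (y - E • x) = x := by
  rw [← h, mem_graph_shift, sub_add_cancel]

theorem HasBoundedInverse.apply_mem_graph {H : V →ₗ.[ℂ] V} {E : ℂ} {R : V →L[ℂ] V}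
    (h : HasBoundedInverse (shift H E) R) (y : V) : (R y, y + E • R y) ∈ H.graph := by
  rw [h.mem_graph_iff, add_sub_cancel_right]

theorem eq_of_hasBoundedInverse_shift {H H' : V →ₗ.[ℂ] V} {E : ℂ} {R : V →L[ℂ] V}
    (h : HasBoundedInverse (shift H E) R) (h' : HasBoundedInverse (shift H' E) R) : H = H' := by
  refine LinearPMap.eq_of_eq_graph ?_
  ext ⟨x, y⟩
  rw [h.mem_graph_iff, h'.mem_graph_iff]

theorem HasBoundedInverse.resolvent_identity {H : V →ₗ.[ℂ] V} {E F : ℂ} {R Q : V →L[ℂ] V}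
    (hR : HasBoundedInverse (shift H E) R) (hQ : HasBoundedInverse (shift H F) Q) :
    Q - R = (F - E) • (Q * R) := by
  ext y
  have h := (hQ.mem_graph_iff _ _).1 (hR.apply_mem_graph y)
  rw [add_sub_assoc, ← sub_smul, map_add, map_smul] at h
  change Q y - R y = (F - E) • Q (R y)
  rw [sub_eq_iff_eq_add', ← neg_sub E F, neg_smul, ← sub_eq_add_neg]
  exact eq_sub_of_add_eq h

theorem HasBoundedInverse.of_resolvent_identity {H : V →ₗ.[ℂ] V} {E F : ℂ} {R Q : V →L[ℂ] V}
    (hR : HasBoundedInverse (shift H E) R) (h₁ : Q - R = (F - E) • (Q * R))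
    (h₂ : R - Q = (E - F) • (R * Q)) : HasBoundedInverse (shift H F) Q := by
  replace h₁ (y : V) : Q y - R y = (F - E) • Q (R y) := DFunLike.congr_fun h₁ y
  replace h₂ (y : V) : R y - Q y = (E - F) • R (Q y) := DFunLike.congr_fun h₂ y
  intro x y
  rw [mem_graph_shift, hR.mem_graph_iff, add_sub_assoc, ← sub_smul]
  constructor
  · intro hx
    have h := h₁ (y + (F - E) • x)
    rw [hx, map_add, map_smul] at h
    rw [← sub_eq_zero] at h ⊢
    rw [← h]
    abel
  · rintro rfl
    rw [map_add, map_smul, ← neg_sub E F, neg_smul, ← h₂, neg_sub, add_sub_cancel]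

theorem HasBoundedInverse.isUnit_one_sub_smul {H : V →ₗ.[ℂ] V} {E F : ℂ} {R Q : V →L[ℂ] V}
    (hR : HasBoundedInverse (shift H E) R) (hQ : HasBoundedInverse (shift H F) Q) :
    IsUnit (1 - (F - E) • R) := by
  have hQR : Q - R = (F - E) • (Q * R) := hR.resolvent_identity hQ
  have hRQ : Q - R = (F - E) • (R * Q) := by
    rw [← neg_sub R Q, hQ.resolvent_identity hR, ← neg_smul, neg_sub]
  refine isUnit_iff_exists.2 ⟨1 + (F - E) • Q, ?_, ?_⟩
  · calc (1 - (F - E) • R) * (1 + (F - E) • Q)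
        = 1 + (F - E) • ((Q - R) - (F - E) • (R * Q)) := by
          simp only [mul_add, sub_mul, one_mul, mul_one, smul_mul_assoc, mul_smul_comm, smul_sub]
          abel
      _ = 1 := by rw [hRQ, sub_self, smul_zero, add_zero]
  · calc (1 + (F - E) • Q) * (1 - (F - E) • R)
        = 1 + (F - E) • ((Q - R) - (F - E) • (Q * R)) := by
          simp only [mul_sub, add_mul, one_mul, mul_one, smul_mul_assoc, mul_smul_comm, smul_sub,
            smul_add]
          abel
      _ = 1 := by rw [hQR, sub_self, smul_zero, add_zero]

theorem HasBoundedInverse.mem_realSpectrum {H : V →ₗ.[ℂ] V} {E r : ℝ} {R : V →L[ℂ] V}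
    (hR : HasBoundedInverse (shift H (E : ℂ)) R) (hr : r ≠ 0) (hspec : (r : ℂ) ∈ spectrum ℂ R) :
    E + r⁻¹ ∈ realSpectrum H := by
  rintro ⟨Q, hQ⟩
  have h : IsUnit ((r : ℂ) • (1 - (r : ℂ)⁻¹ • R)) := by
    have := hR.isUnit_one_sub_smul hQ
    push_cast at this
    rw [add_sub_cancel_left] at this
    exact (isUnit_smul_iff (Units.mk0 (r : ℂ) (by exact_mod_cast hr)) _).2 this
  rw [smul_sub, smul_smul, mul_inv_cancel₀ (by exact_mod_cast hr), one_smul,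
    ← Algebra.algebraMap_eq_smul_one] at h
  exact hspec h

end Resolvent

section SelfAdjoint

variable {V : Type*} [NormedAddCommGroup V] [InnerProductSpace ℂ V]

theorem realSpectrum_nonempty [CompleteSpace V] [Nontrivial V] {H : V →ₗ.[ℂ] V} {E : ℝ}
    {R : V →L[ℂ] V} (hR : HasBoundedInverse (shift H (E : ℂ)) R) (hsa : IsSelfAdjoint R) :
    (realSpectrum H).Nonempty := by
  have hR0 : R ≠ 0 := by
    rintro rfl
    obtain ⟨x, hx⟩ := exists_ne (0 : V)
    exact hx (hR.injective (by simp))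
  obtain ⟨z, hz, hz'⟩ := spectrum.exists_nnnorm_eq_spectralRadius R
  rw [hsa.spectralRadius_eq_nnnorm, ENNReal.coe_inj] at hz'
  have hzr : z = (z.re : ℂ) := hsa.mem_spectrum_eq_re hz
  refine ⟨_, hR.mem_realSpectrum (r := z.re) (fun h0 => hR0 ?_) (hzr ▸ hz)⟩
  rw [← nnnorm_eq_zero, ← hz', hzr, h0, Complex.ofReal_zero, nnnorm_zero]

/-- The operator `H = R⁻¹ + E`, which has `(H - E)⁻¹ = R` when `R` is injective. -/
def ofResolvent (R : V →L[ℂ] V) (E : ℂ) : V →ₗ.[ℂ] V :=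
  shift ((R : V →ₗ[ℂ] V).toPMap ⊤).inverse (-E)

theorem mem_graph_ofResolvent {R : V →L[ℂ] V} (hR : Function.Injective R) (E : ℂ) (x y : V) :
    (x, y) ∈ (ofResolvent R E).graph ↔ R (y - E • x) = x := by
  have hker : LinearMap.ker ((R : V →ₗ[ℂ] V).toPMap ⊤).toFun = ⊥ :=
    LinearMap.ker_eq_bot'.2 fun z hz => Subtype.ext (hR (hz.trans (map_zero R).symm))
  rw [ofResolvent, mem_graph_shift, LinearPMap.inverse_graph hker, neg_smul, ← sub_eq_add_neg]
  refine Iff.trans ⟨?_, fun h => ⟨_, h, rfl⟩⟩ (mem_graph_toPMap_top (R : V →ₗ[ℂ] V) _ _)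
  rintro ⟨⟨a, b⟩, h, hab⟩
  obtain ⟨rfl, rfl⟩ : b = x ∧ a = y - E • x := Prod.mk.inj hab
  exact h

theorem hasBoundedInverse_ofResolvent {R : V →L[ℂ] V} (hR : Function.Injective R) (E : ℂ) :
    HasBoundedInverse (shift (ofResolvent R E) E) R := by
  intro x y
  rw [mem_graph_shift, mem_graph_ofResolvent hR, add_sub_cancel_right]

variable [CompleteSpace V]

theorem denseRange_of_isSelfAdjoint {R : V →L[ℂ] V} (hR : Function.Injective R)
    (hsa : IsSelfAdjoint R) : DenseRange R := by
  have h : R.rangeᗮ = ⊥ := by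
    rw [ContinuousLinearMap.orthogonal_range, hsa.adjoint_eq]
    exact LinearMap.ker_eq_bot.2 hR
  have := Submodule.dense_iff_topologicalClosure_eq_top.2
    ((Submodule.topologicalClosure_eq_top_iff (K := R.range)).2 h)
  rwa [LinearMap.coe_range] at this

theorem isSelfAdjoint_ofResolvent {R : V →L[ℂ] V} (hR : Function.Injective R)
    (hsa : IsSelfAdjoint R) (E : ℝ) : IsSelfAdjoint (ofResolvent R E) := by
  have hgraph : ∀ x, (R x, x + (E : ℂ) • R x) ∈ (ofResolvent R E).graph :=
    (hasBoundedInverse_ofResolvent hR E).apply_mem_graph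
  have hdense : Dense ((ofResolvent R E).domain : Set V) :=
    (denseRange_of_isSelfAdjoint hR hsa).mono
      (by rintro _ ⟨x, rfl⟩; exact LinearPMap.mem_domain_of_mem_graph (hgraph x))
  have hsymm : ∀ x y, inner ℂ (R x) y = inner ℂ x (R y) := hsa.isSymmetric
  rw [LinearPMap.isSelfAdjoint_def]
  refine LinearPMap.eq_of_eq_graph ?_
  rw [LinearPMap.adjoint_graph_eq_graph_adjoint hdense]
  ext ⟨x, y⟩
  rw [Submodule.mem_adjoint_iff, mem_graph_ofResolvent hR]
  constructor
  · intro h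
    refine ext_inner_left ℂ fun c => ?_
    have hc := h (R c) (c + (E : ℂ) • R c) (hgraph c)
    simp only [inner_add_left, inner_smul_left, hsymm, Complex.conj_ofReal] at hc
    simp only [map_sub, map_smul, inner_sub_right, inner_smul_right]
    linear_combination -hc
  · intro h a b hab
    rw [mem_graph_ofResolvent hR] at hab
    have hx : inner ℂ (b - (E : ℂ) • a) x = inner ℂ a (y - (E : ℂ) • x) := by
      conv_lhs => rw [← h]
      rw [← hsymm, hab]
    simp only [inner_sub_left, inner_sub_right, inner_smul_left, inner_smul_right,
      Complex.conj_ofReal] at hx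
    linear_combination hx

end SelfAdjoint

/-! ### Relatively bounded perturbations -/

section RelativelyBounded

variable {V : Type*} [NormedAddCommGroup V] [NormedSpace ℂ V] {K S' U : V →ₗ.[ℂ] V}
  {S W : V →L[ℂ] V}

theorem pcomp_pcomp_eq_toPMap (hS : ∀ x y, (x, y) ∈ S'.graph ↔ S x = y)
    (hW : ∀ x y, (S x, y) ∈ U.graph ↔ W x = y) :
    pcomp S' (pcomp U S') = ((S * W : V →L[ℂ] V) : V →ₗ[ℂ] V).toPMap ⊤ := by
  refine LinearPMap.eq_of_eq_graph ?_
  ext ⟨x, z⟩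
  simp only [mem_graph_pcomp, mem_graph_toPMap_top, hS, exists_eq_left', hW]
  rfl

theorem HasBoundedInverse.sub_of_norm_lt_one [CompleteSpace V]
    (hK : ∀ x y, (x, y) ∈ K.graph ↔ S (S y) = x)
    (hW : ∀ x y, (S x, y) ∈ U.graph ↔ W x = y) (hSW : ‖S * W‖ < 1) :
    HasBoundedInverse (K - U) (S * Ring.inverse (1 - S * W) * S) := by
  have hunit := isUnit_one_sub_of_norm_lt_one hSW
  set G := Ring.inverse (1 - S * W)
  have hG₁ (x : V) : G (x - S (W x)) = x :=
    DFunLike.congr_fun (Ring.inverse_mul_cancel _ hunit) x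
  have hG₂ (x : V) : G x - S (W (G x)) = x :=
    DFunLike.congr_fun (Ring.mul_inverse_cancel _ hunit) x
  intro x y
  rw [mem_graph_sub]
  change _ ↔ S (G (S y)) = x
  constructor
  · rintro ⟨a, b, ha, hb, rfl⟩
    rw [hK] at ha
    rw [← ha, hW] at hb
    rw [← hb, map_sub, hG₁, ha]
  · rintro rfl
    refine ⟨y + W (G (S y)), W (G (S y)), ?_, (hW _ _).2 rfl, by abel⟩
    rw [hK, map_add, ← sub_eq_iff_eq_add.1 (hG₂ (S y))]

end RelativelyBounded

/-! ### Block operators -/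

section BlockOperator

variable {V W : Type*} [NormedAddCommGroup V] [NormedAddCommGroup W]

section NormedSpace

variable [NormedSpace ℂ V] [NormedSpace ℂ W] {A A₀ : V →L[ℂ] V} {B B₀ : V →L[ℂ] W}
  {C C₀ : W →L[ℂ] V} {Ψ Ψ₀ : W →L[ℂ] W}

/-- The operator with blocks `A + C Ψ B`, `-C Ψ`, `-Ψ B`, `Ψ` on the Hilbert sum of `V` and `W`:
the inverse of `[a b†; b a']` by Schur complement, with `A = a⁻¹`, `B = b a⁻¹`, `C = a⁻¹ b†` and
`Ψ = (a' - b a⁻¹ b†)⁻¹`. -/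
def blockOperator (A : V →L[ℂ] V) (B : V →L[ℂ] W) (C : W →L[ℂ] V) (Ψ : W →L[ℂ] W) :
    WithLp 2 (V × W) →L[ℂ] WithLp 2 (V × W) :=
  let e := WithLp.prodContinuousLinearEquiv 2 ℂ V W
  let f := ContinuousLinearMap.fst ℂ V W
  let v := Ψ ∘L (ContinuousLinearMap.snd ℂ V W - B ∘L f)
  (e.symm : V × W →L[ℂ] WithLp 2 (V × W)) ∘L ((A ∘L f - C ∘L v).prod v) ∘L
    (e : WithLp 2 (V × W) →L[ℂ] V × W)

theorem blockOperator_apply (f : V) (g : W) :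
    blockOperator A B C Ψ (WithLp.toLp 2 (f, g)) =
      WithLp.toLp 2 (A f - C (Ψ (g - B f)), Ψ (g - B f)) :=
  rfl

theorem blockOperator_injective (hA : Function.Injective A) (hΨ : Function.Injective Ψ) :
    Function.Injective (blockOperator A B C Ψ) := by
  rintro ⟨f, g⟩ ⟨f', g'⟩ h
  simp only [blockOperator_apply] at h
  obtain ⟨h₁, h₂⟩ := Prod.mk.inj (WithLp.toLp_injective 2 h)
  rw [h₂, sub_left_inj] at h₁
  obtain rfl := hA h₁
  obtain rfl := sub_left_injective (hΨ h₂)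
  rfl

theorem blockOperator_sub {d : ℂ} (hA : A - A₀ = d • A ∘L A₀) (hB : B - B₀ = d • B ∘L A₀)
    (hC : C - C₀ = d • A ∘L C₀) (hΨ : Ψ - Ψ₀ = d • Ψ ∘L (Ψ₀ + B ∘L C₀ ∘L Ψ₀)) :
    blockOperator A B C Ψ - blockOperator A₀ B₀ C₀ Ψ₀ =
      d • (blockOperator A B C Ψ * blockOperator A₀ B₀ C₀ Ψ₀) := by
  replace hA (f : V) : A f - A₀ f = d • A (A₀ f) := DFunLike.congr_fun hA f
  replace hB (f : V) : B f - B₀ f = d • B (A₀ f) := DFunLike.congr_fun hB f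
  replace hC (g : W) : C g - C₀ g = d • A (C₀ g) := DFunLike.congr_fun hC g
  replace hΨ (g : W) : Ψ g - Ψ₀ g = d • Ψ (Ψ₀ g + B (C₀ (Ψ₀ g))) := DFunLike.congr_fun hΨ g
  ext ⟨f, g⟩ : 1
  change blockOperator A B C Ψ (WithLp.toLp 2 (f, g)) -
      blockOperator A₀ B₀ C₀ Ψ₀ (WithLp.toLp 2 (f, g)) =
    d • blockOperator A B C Ψ (blockOperator A₀ B₀ C₀ Ψ₀ (WithLp.toLp 2 (f, g)))
  simp only [blockOperator_apply]
  set v₀ := Ψ₀ (g - B₀ f) with hv₀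
  set v := Ψ (g - B f) with hv
  have hdown : d • Ψ (v₀ - B (A₀ f - C₀ v₀)) = v - v₀ := by
    have h : v₀ - B (A₀ f - C₀ v₀) = v₀ + B (C₀ v₀) - B (A₀ f) := by
      rw [map_sub]; abel
    rw [h, map_sub, smul_sub, ← hΨ, ← hv₀, ← map_smul Ψ, ← hB, hv]
    simp only [map_sub]
    abel
  rw [← WithLp.toLp_sub, ← WithLp.toLp_smul, Prod.smul_mk, hdown, Prod.mk_sub_mk]
  congr 2
  rw [smul_sub, ← map_smul C, hdown, map_sub A, smul_sub, ← hA, ← hC, map_sub C]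
  abel

end NormedSpace

variable [InnerProductSpace ℂ V] [InnerProductSpace ℂ W] [CompleteSpace V] [CompleteSpace W]

theorem isSelfAdjoint_blockOperator {A : V →L[ℂ] V} {B : V →L[ℂ] W} {Ψ : W →L[ℂ] W}
    (hA : IsSelfAdjoint A) (hΨ : IsSelfAdjoint Ψ) :
    IsSelfAdjoint (blockOperator A B B.adjoint Ψ) := by
  rw [ContinuousLinearMap.isSelfAdjoint_iff_isSymmetric]
  rintro ⟨f, g⟩ ⟨f', g'⟩
  change inner ℂ (blockOperator A B B.adjoint Ψ (WithLp.toLp 2 (f, g))) (WithLp.toLp 2 (f', g')) =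
    inner ℂ (WithLp.toLp 2 (f, g)) (blockOperator A B B.adjoint Ψ (WithLp.toLp 2 (f', g')))
  have hA' : inner ℂ (A f) f' = inner ℂ f (A f') := hA.isSymmetric f f'
  have hΨ' : inner ℂ (Ψ (g - B f)) (g' - B f') = inner ℂ (g - B f) (Ψ (g' - B f')) :=
    hΨ.isSymmetric _ _
  simp only [blockOperator_apply, WithLp.prod_inner_apply]
  rw [inner_sub_left, inner_sub_right, hA', ContinuousLinearMap.adjoint_inner_left,
    ContinuousLinearMap.adjoint_inner_right]
  rw [inner_sub_right, inner_sub_left] at hΨ'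
  linear_combination hΨ'

end BlockOperator

/-! ### Square integrable functions -/

section SquareIntegrable

variable {α 𝕜 : Type*} [MeasurableSpace α] {μ : Measure α}

theorem eLpNorm_two_sq [NormedAddCommGroup 𝕜] (f : α → 𝕜) :
    eLpNorm f 2 μ ^ 2 = ∫⁻ a, ‖f a‖ₑ ^ 2 ∂μ := by
  simpa using eLpNorm_nnreal_pow_eq_lintegral (μ := μ) (f := f) (p := 2) (by norm_num)

theorem memLp_two_iff_lintegral_enorm_sq_lt_top [NormedAddCommGroup 𝕜] {f : α → 𝕜}
    (hf : AEStronglyMeasurable f μ) : MemLp f 2 μ ↔ ∫⁻ a, ‖f a‖ₑ ^ 2 ∂μ < ⊤ := by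
  rw [← eLpNorm_two_sq, ENNReal.pow_lt_top_iff, MemLp]
  simp [hf]

theorem lintegral_mul_sq_le {f g : α → ENNReal} (hf : AEMeasurable f μ) (hg : AEMeasurable g μ) :
    (∫⁻ a, f a * g a ∂μ) ^ 2 ≤ (∫⁻ a, f a ^ 2 ∂μ) * ∫⁻ a, g a ^ 2 ∂μ := by
  have h := ENNReal.lintegral_mul_le_Lp_mul_Lq μ Real.HolderConjugate.two_two hf hg
  calc (∫⁻ a, f a * g a ∂μ) ^ 2
      ≤ ((∫⁻ a, f a ^ (2 : ℝ) ∂μ) ^ (1 / (2 : ℝ)) *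
          (∫⁻ a, g a ^ (2 : ℝ) ∂μ) ^ (1 / (2 : ℝ))) ^ 2 := by
        gcongr
        exact h
    _ = _ := by
        rw [mul_pow, ← ENNReal.rpow_natCast, ← ENNReal.rpow_natCast, ← ENNReal.rpow_mul,
          ← ENNReal.rpow_mul]
        norm_num

theorem enorm_integral_mul_sq_le [NormedDivisionRing 𝕜] [NormedSpace ℝ 𝕜] {f g : α → 𝕜}
    (hf : AEStronglyMeasurable f μ) (hg : AEStronglyMeasurable g μ) :
    ‖∫ a, f a * g a ∂μ‖ₑ ^ 2 ≤ (∫⁻ a, ‖f a‖ₑ ^ 2 ∂μ) * ∫⁻ a, ‖g a‖ₑ ^ 2 ∂μ := by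
  refine le_trans ?_ (lintegral_mul_sq_le hf.enorm hg.enorm)
  gcongr
  simpa only [enorm_mul] using enorm_integral_le_lintegral_enorm (μ := μ) fun a => f a * g a

end SquareIntegrable

/-! ### The momentum measure -/

theorem measurable_omega (m : ℝ) : Measurable (omega m) := by
  unfold omega; fun_prop

theorem ae_momentum_pos : ∀ᵐ p ∂momentumMeasure, 0 < p.1 :=
  (withDensity_absolutelyContinuous _ _).ae_le <|
    ae_restrict_mem (measurableSet_lt measurable_const measurable_fst)

theorem le_omega {m : ℝ} {p : ℝ × ℝ} (hp : 0 < p.1) : m ≤ omega m p := by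
  rw [omega, le_div_iff₀ (by positivity)]
  nlinarith [sq_nonneg (m - p.1), sq_nonneg p.2]

theorem ae_le_omega (m : ℝ) : ∀ᵐ p ∂momentumMeasure, m ≤ omega m p :=
  ae_momentum_pos.mono fun _ hp => le_omega hp

theorem lintegral_eq_ofReal_mul_lintegral_mul_left {f : ℝ → ENNReal} (hf : Measurable f) {a : ℝ}
    (ha : 0 < a) : ∫⁻ x, f x = ENNReal.ofReal a * ∫⁻ t, f (a * t) := by
  conv_lhs => rw [← Real.smul_map_volume_mul_left ha.ne', abs_of_pos ha]
  rw [lintegral_smul_measure, lintegral_map hf (by fun_prop), smul_eq_mul]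

theorem lintegral_momentumMeasure {f : ℝ × ℝ → ENNReal} (hf : Measurable f) :
    ∫⁻ p, f p ∂momentumMeasure = ∫⁻ t : ℝ, ∫⁻ p in Set.Ioi (0 : ℝ),
      ENNReal.ofReal (1 / (8 * Real.pi ^ 2)) * f (p, p * t) := by
  have hdensity : Measurable fun k : ℝ × ℝ =>
      ENNReal.ofReal (1 / ((2 * Real.pi) ^ 2 * (2 * k.1))) := by fun_prop
  have hhalfspace : {k : ℝ × ℝ | 0 < k.1} = Set.Ioi (0 : ℝ) ×ˢ Set.univ := by
    ext; simp
  rw [momentumMeasure, lintegral_withDensity_eq_lintegral_mul _ hdensity hf, hhalfspace,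
    Measure.volume_eq_prod, ← Measure.prod_restrict, Measure.restrict_univ,
    lintegral_prod _ (hdensity.mul hf).aemeasurable,
    lintegral_lintegral_swap (μ := volume) (ν := volume.restrict (Set.Ioi (0 : ℝ)))
      (Measurable.aemeasurable (by fun_prop))]
  refine setLIntegral_congr_fun measurableSet_Ioi fun p hp => ?_
  have hp : (0 : ℝ) < p := hp
  have hfp : Measurable fun q : ℝ => f (p, q) := by fun_prop
  simp only [Pi.mul_apply]
  rw [lintegral_const_mul _ hfp, lintegral_const_mul _ (by fun_prop),
    lintegral_eq_ofReal_mul_lintegral_mul_left hfp hp, ← mul_assoc,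
    ← ENNReal.ofReal_mul (by positivity)]
  congr 2
  field_simp
  norm_num

theorem lintegral_Ioi_inv_sq {a c : ℝ} (ha : 0 < a) (hc : 0 < c) :
    ∫⁻ p in Set.Ioi (0 : ℝ), ENNReal.ofReal (((c + a * p) ^ 2)⁻¹) = ENNReal.ofReal ((a * c)⁻¹) := by
  have hderiv : ∀ p ∈ Set.Ici (0 : ℝ),
      HasDerivAt (fun p => -(a * (c + a * p))⁻¹) (((c + a * p) ^ 2)⁻¹) p := by
    intro p (hp : 0 ≤ p)
    have h : HasDerivAt (fun p => a * (c + a * p)) (a * (a * 1)) p :=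
      (((hasDerivAt_id p).const_mul a).const_add c).const_mul a
    refine (h.inv (by positivity)).neg.congr_deriv ?_
    field_simp
  have hlim : Filter.Tendsto (fun p => -(a * (c + a * p))⁻¹) Filter.atTop (nhds 0) := by
    rw [← neg_zero]
    exact (Filter.Tendsto.const_mul_atTop ha <| Filter.tendsto_atTop_add_const_left _ _ <|
      Filter.tendsto_id.const_mul_atTop ha).inv_tendsto_atTop.neg
  have hpos : ∀ p ∈ Set.Ioi (0 : ℝ), 0 ≤ ((c + a * p) ^ 2)⁻¹ := fun p _ => by positivity
  have hint := integrableOn_Ioi_deriv_of_nonneg' hderiv hpos hlim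
  rw [← ofReal_integral_eq_lintegral_ofReal hint
    ((ae_restrict_iff' measurableSet_Ioi).2 (ae_of_all _ hpos)),
    integral_Ioi_of_hasDerivAt_of_tendsto' hderiv hint hlim]
  simp

theorem lintegral_inv_omega_add_sq_le (m : ℝ) {c : ℝ} (hc : 0 < c) :
    ∫⁻ p, ENNReal.ofReal (((omega m p + c) ^ 2)⁻¹) ∂momentumMeasure ≤
      ENNReal.ofReal (1 / (4 * Real.pi * c)) := by
  have hm := measurable_omega m
  rw [lintegral_momentumMeasure (by fun_prop)]
  calc
    _ ≤ ∫⁻ t : ℝ, ∫⁻ p in Set.Ioi (0 : ℝ), ENNReal.ofReal (1 / (8 * Real.pi ^ 2)) *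
          ENNReal.ofReal (((c + (1 + t ^ 2) / 2 * p) ^ 2)⁻¹) := by
        refine lintegral_mono fun t => setLIntegral_mono' measurableSet_Ioi fun p hp => ?_
        have hp : (0 : ℝ) < p := hp
        have homega : omega m (p, p * t) = m ^ 2 / (2 * p) + (1 + t ^ 2) / 2 * p := by
          simp only [omega]
          field_simp
          ring
        have hmass : 0 ≤ m ^ 2 / (2 * p) := by positivity
        have hle : c + (1 + t ^ 2) / 2 * p ≤ omega m (p, p * t) + c := by linarith
        gcongr
    _ = ∫⁻ t : ℝ, ENNReal.ofReal (1 / (4 * Real.pi ^ 2 * c)) *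
          ENNReal.ofReal ((1 + t ^ 2)⁻¹) := by
        refine lintegral_congr fun t => ?_
        rw [lintegral_const_mul _ (by fun_prop), lintegral_Ioi_inv_sq (by positivity) hc,
          ← ENNReal.ofReal_mul (by positivity), ← ENNReal.ofReal_mul (by positivity)]
        congr 1
        field_simp
        norm_num
    _ = ENNReal.ofReal (1 / (4 * Real.pi * c)) := by
        rw [lintegral_const_mul _ (by fun_prop), ← ofReal_integral_eq_lintegral_ofReal
          integrable_inv_one_add_sq (ae_of_all _ fun t => by positivity),
          integral_univ_inv_one_add_sq, ← ENNReal.ofReal_mul (by positivity)]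
        congr 1
        field_simp

theorem exists_lintegral_inv_sq_le {m d : ℝ} (hm : 0 < m) (hd : 0 < d) :
    ∃ C : NNReal, ∀ z : ℂ, d - m ≤ z.re →
      ∫⁻ p, ‖(z + omega m p)⁻¹‖ₑ ^ 2 ∂momentumMeasure ≤ C := by
  obtain ⟨t, ht0, ht1, htd⟩ : ∃ t : ℝ, 0 < t ∧ t ≤ 1 ∧ t * m ≤ d :=
    ⟨min 1 (d / m), by positivity, min_le_left _ _, by
      calc min 1 (d / m) * m ≤ d / m * m := by gcongr; exact min_le_right _ _
        _ = d := by field_simp⟩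
  refine ⟨(ENNReal.ofReal ((4 / t ^ 2) * (1 / (4 * Real.pi * m)))).toNNReal, fun z hz => ?_⟩
  rw [ENNReal.coe_toNNReal ENNReal.ofReal_ne_top, ENNReal.ofReal_mul (by positivity)]
  refine le_trans ?_ (mul_le_mul_right (lintegral_inv_omega_add_sq_le m hm) _)
  have hmeas := measurable_omega m
  rw [← lintegral_const_mul _ (by fun_prop)]
  refine lintegral_mono_ae ?_
  filter_upwards [ae_le_omega m] with p hp
  rw [← ENNReal.ofReal_mul (by positivity), ← ofReal_norm,
    ← ENNReal.ofReal_pow (norm_nonneg _)]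
  refine ENNReal.ofReal_le_ofReal ?_
  have hle : t / 2 * (omega m p + m) ≤ ‖z + omega m p‖ := by
    refine le_trans ?_ (Complex.re_le_norm _)
    simp only [Complex.add_re, Complex.ofReal_re]
    nlinarith
  have hpos : 0 < omega m p + m := by linarith
  rw [norm_inv, inv_pow]
  calc (‖z + omega m p‖ ^ 2)⁻¹ ≤ ((t / 2 * (omega m p + m)) ^ 2)⁻¹ := by gcongr
    _ = _ := by field_simp; norm_num

theorem memLp_inv_add_omega {m : ℝ} (hm : 0 < m) {z : ℂ} (hz : -m < z.re) :
    MemLp (fun p => (z + omega m p)⁻¹) 2 momentumMeasure := by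
  obtain ⟨C, hC⟩ := exists_lintegral_inv_sq_le hm (d := z.re + m) (by linarith)
  have hmeas := measurable_omega m
  exact (memLp_two_iff_lintegral_enorm_sq_lt_top
    (Measurable.aestronglyMeasurable (by fun_prop))).2
    ((hC z (by linarith)).trans_lt ENNReal.coe_lt_top)

theorem integrable_inv_mul_inv {m : ℝ} (hm : 0 < m) {z w : ℂ} (hz : -m < z.re) (hw : -m < w.re) :
    Integrable (fun p => (z + omega m p)⁻¹ * (w + omega m p)⁻¹) momentumMeasure :=
  (memLp_inv_add_omega hm hz).integrable_mul (memLp_inv_add_omega hm hw)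

/-! ### Adding, removing and replacing a momentum -/

theorem measurable_freeEnergy (m : ℝ) (n : ℕ) :
    Measurable (freeEnergy m : (Fin n → ℝ × ℝ) → ℝ) := by
  unfold freeEnergy
  exact Finset.measurable_sum _ fun i _ => (measurable_omega m).comp (measurable_pi_apply i)

theorem ae_momenta_pos (n : ℕ) : ∀ᵐ k ∂nMeasure n, ∀ i, 0 < (k i).1 :=
  ae_all_iff.2 fun i =>
    (Measure.quasiMeasurePreserving_eval (μ := fun _ : Fin n => momentumMeasure) i).ae
      ae_momentum_pos

theorem le_freeEnergy (m : ℝ) {n : ℕ} {k : Fin n → ℝ × ℝ} (hk : ∀ i, 0 < (k i).1) :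
    n * m ≤ freeEnergy m k := by
  simpa [freeEnergy] using Finset.card_nsmul_le_sum Finset.univ (fun i => omega m (k i)) m
    fun i _ => le_omega (hk i)

theorem ae_le_freeEnergy (m : ℝ) (n : ℕ) : ∀ᵐ k ∂nMeasure n, n * m ≤ freeEnergy m k :=
  (ae_momenta_pos n).mono fun _ => le_freeEnergy m

theorem freeEnergy_insertNth (m : ℝ) {n : ℕ} (i : Fin (n + 1)) (p : ℝ × ℝ)
    (r : Fin n → ℝ × ℝ) :
    freeEnergy m (i.insertNth p r : Fin (n + 1) → ℝ × ℝ) = omega m p + freeEnergy m r := by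
  simp [freeEnergy, Fin.sum_univ_succAbove _ i]

theorem freeEnergy_cons (m : ℝ) {n : ℕ} (p : ℝ × ℝ) (r : Fin n → ℝ × ℝ) :
    freeEnergy m (Fin.cons p r : Fin (n + 1) → ℝ × ℝ) = omega m p + freeEnergy m r := by
  rw [← Fin.insertNth_zero', freeEnergy_insertNth]

theorem freeEnergy_comp_perm (m : ℝ) {n : ℕ} (k : Fin n → ℝ × ℝ) (σ : Equiv.Perm (Fin n)) :
    freeEnergy m (k ∘ σ) = freeEnergy m k :=
  Equiv.sum_comp σ fun i => omega m (k i)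

theorem update_comp_perm {ι X : Type*} [DecidableEq ι] (k : ι → X) (σ : Equiv.Perm ι) (i : ι)
    (p : X) : Function.update (k ∘ σ) i p = Function.update k (σ i) p ∘ σ := by
  rw [Function.update_comp_equiv, Equiv.symm_apply_apply]

section InsertNth

variable {n : ℕ} (i : Fin (n + 1))

theorem measurable_insertNth : Measurable fun q : (ℝ × ℝ) × (Fin n → ℝ × ℝ) =>
    (i.insertNth q.1 q.2 : Fin (n + 1) → ℝ × ℝ) :=
  (measurePreserving_insertNth n i).measurable

theorem lintegral_insertNth {f : (Fin (n + 1) → ℝ × ℝ) → ENNReal} (hf : Measurable f) :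
    ∫⁻ k, f k ∂nMeasure (n + 1) =
      ∫⁻ r, ∫⁻ p, f (i.insertNth p r) ∂momentumMeasure ∂nMeasure n := by
  rw [← (measurePreserving_insertNth n i).lintegral_comp hf]
  exact lintegral_prod_symm' _ (hf.comp (measurable_insertNth i))

theorem ae_insertNth {P : (Fin (n + 1) → ℝ × ℝ) → Prop} (h : ∀ᵐ k ∂nMeasure (n + 1), P k) :
    ∀ᵐ r ∂nMeasure n, ∀ᵐ p ∂momentumMeasure, P (i.insertNth p r) :=
  Measure.ae_ae_of_ae_prod <|
    (Measure.measurePreserving_swap (μ := nMeasure n)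
      (ν := momentumMeasure)).quasiMeasurePreserving.ae <|
    (measurePreserving_insertNth n i).quasiMeasurePreserving.ae h

theorem integral_insertNth {f : (Fin (n + 1) → ℝ × ℝ) → ℂ} (hf : Integrable f (nMeasure (n + 1))) :
    ∫ k, f k ∂nMeasure (n + 1) =
      ∫ r, ∫ p, f (i.insertNth p r) ∂momentumMeasure ∂nMeasure n := by
  have hmp := measurePreserving_insertNth n i
  refine Eq.trans ?_ (integral_prod_symm _ (hmp.integrable_comp_of_integrable hf))
  rw [← hmp.map_eq] at hf ⊢
  exact integral_map hmp.measurable.aemeasurable hf.aestronglyMeasurable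

theorem ae_memLp_insertNth {f : (Fin (n + 1) → ℝ × ℝ) → ℂ} (hfm : Measurable f)
    (hf : MemLp f 2 (nMeasure (n + 1))) :
    ∀ᵐ r ∂nMeasure n, MemLp (fun p => f (i.insertNth p r)) 2 momentumMeasure := by
  have hsq : Measurable fun k => ‖f k‖ₑ ^ 2 := by fun_prop
  have hfin := (memLp_two_iff_lintegral_enorm_sq_lt_top hf.1).1 hf
  rw [lintegral_insertNth i hsq] at hfin
  have hslice : Measurable fun q : (Fin n → ℝ × ℝ) × (ℝ × ℝ) => ‖f (i.insertNth q.2 q.1)‖ₑ ^ 2 :=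
    hsq.comp ((measurable_insertNth i).comp measurable_swap)
  filter_upwards [ae_lt_top hslice.lintegral_prod_right' hfin.ne] with r hr
  exact (memLp_two_iff_lintegral_enorm_sq_lt_top (hfm.comp ((measurable_insertNth i).comp
    measurable_prodMk_right)).aestronglyMeasurable).2 hr

end InsertNth

/-! ### States and operators on Fock sectors -/

section States

variable {n n' : ℕ}

theorem measurable_amp (ψ : Fock n) : Measurable (amp ψ) :=
  (Lp.stronglyMeasurable _).measurable

theorem memLp_amp (ψ : Fock n) : MemLp (amp ψ) 2 (nMeasure n) :=
  Lp.memLp _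

theorem ae_amp_comp_perm (ψ : Fock n) (σ : Equiv.Perm (Fin n)) :
    ∀ᵐ k ∂nMeasure n, amp ψ (k ∘ σ) = amp ψ k :=
  ψ.2 σ

theorem ae_memLp_update (i : Fin n) (ψ : Fock n) :
    ∀ᵐ k ∂nMeasure n, MemLp (fun p => amp ψ (Function.update k i p)) 2 momentumMeasure := by
  cases n with
  | zero => exact i.elim0
  | succ n =>
    filter_upwards [ae_removeNth i (ae_memLp_insertNth i (measurable_amp ψ) (memLp_amp ψ))]
      with k hk
    simpa [Fin.insertNth_removeNth] using hk

theorem ae_memLp_cons (f : Fock (n + 1)) :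
    ∀ᵐ k ∂nMeasure n, MemLp (fun p => amp f (Fin.cons p k)) 2 momentumMeasure := by
  simpa [Fin.insertNth_zero'] using ae_memLp_insertNth 0 (measurable_amp f) (memLp_amp f)

theorem enorm_sq_eq_lintegral (ψ : Fock n) : ‖ψ‖ₑ ^ 2 = ∫⁻ k, ‖amp ψ k‖ₑ ^ 2 ∂nMeasure n := by
  rw [← eLpNorm_two_sq, amp, ← Lp.enorm_def]
  rfl

theorem inner_eq_integral (φ ψ : Fock n) :
    inner ℂ φ ψ = ∫ k, amp ψ k * (starRingEnd ℂ) (amp φ k) ∂nMeasure n := by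
  change inner ℂ (φ : Lp ℂ 2 (nMeasure n)) (ψ : Lp ℂ 2 (nMeasure n)) = _
  rw [L2.inner_def]
  rfl

theorem exists_amp_ae_eq {f : (Fin n → ℝ × ℝ) → ℂ} (hf : MemLp f 2 (nMeasure n))
    (hsymm : ∀ σ : Equiv.Perm (Fin n), ∀ᵐ k ∂nMeasure n, f (k ∘ σ) = f k) :
    ∃ χ : Fock n, amp χ =ᵐ[nMeasure n] f := by
  refine ⟨⟨hf.toLp f, fun σ => ?_⟩, hf.coeFn_toLp⟩
  filter_upwards [hf.coeFn_toLp, hsymm σ,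
    (measurePreserving_perm n σ).quasiMeasurePreserving.ae hf.coeFn_toLp] with k hk hσ hkσ
  rw [hk, hkσ, hσ]

theorem norm_le_of_lintegral_le {ψ : Fock n} {χ : Fock n'} {C : NNReal}
    (h : ∫⁻ k, ‖amp χ k‖ₑ ^ 2 ∂nMeasure n' ≤ C ^ 2 * ∫⁻ k, ‖amp ψ k‖ₑ ^ 2 ∂nMeasure n) :
    ‖χ‖ ≤ C * ‖ψ‖ := by
  rw [← enorm_sq_eq_lintegral, ← enorm_sq_eq_lintegral, ← mul_pow,
    ENNReal.pow_le_pow_left_iff two_ne_zero, enorm_eq_nnnorm, enorm_eq_nnnorm,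
    ← ENNReal.coe_mul, ENNReal.coe_le_coe] at h
  exact_mod_cast h

theorem amp_ae_eq_iff {T : Fock n → Fock n'} {F : Fock n → (Fin n' → ℝ × ℝ) → ℂ}
    (hT : ∀ ψ, amp (T ψ) =ᵐ[nMeasure n'] F ψ) (ψ : Fock n) (χ : Fock n') :
    amp χ =ᵐ[nMeasure n'] F ψ ↔ T ψ = χ :=
  ⟨fun h => amp_ext ((hT ψ).trans h.symm), fun h => h ▸ hT ψ⟩

theorem exists_clm_amp_ae_eq {F : Fock n → (Fin n' → ℝ × ℝ) → ℂ} {C : NNReal}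
    (hadd : ∀ ψ χ, F (ψ + χ) =ᵐ[nMeasure n'] F ψ + F χ)
    (hsmul : ∀ (c : ℂ) ψ, F (c • ψ) =ᵐ[nMeasure n'] c • F ψ)
    (hmeas : ∀ ψ, AEStronglyMeasurable (F ψ) (nMeasure n'))
    (hsymm : ∀ ψ (σ : Equiv.Perm (Fin n')), ∀ᵐ k ∂nMeasure n', F ψ (k ∘ σ) = F ψ k)
    (hbound : ∀ ψ, ∫⁻ k, ‖F ψ k‖ₑ ^ 2 ∂nMeasure n' ≤
      C ^ 2 * ∫⁻ k, ‖amp ψ k‖ₑ ^ 2 ∂nMeasure n) :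
    ∃ T : Fock n →L[ℂ] Fock n', ‖T‖ ≤ C ∧ ∀ ψ, amp (T ψ) =ᵐ[nMeasure n'] F ψ := by
  have hfin (ψ : Fock n) : MemLp (F ψ) 2 (nMeasure n') :=
    (memLp_two_iff_lintegral_enorm_sq_lt_top (hmeas ψ)).2 <| (hbound ψ).trans_lt <|
      ENNReal.mul_lt_top (by simp)
        ((memLp_two_iff_lintegral_enorm_sq_lt_top (memLp_amp ψ).1).1 (memLp_amp ψ))
  choose T hT using fun ψ => exists_amp_ae_eq (hfin ψ) (hsymm ψ)
  let L : Fock n →ₗ[ℂ] Fock n' :=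
    { toFun := T
      map_add' := fun ψ χ => amp_ext <| (hT _).trans <| (hadd ψ χ).trans <|
        ((hT ψ).add (hT χ)).symm.trans (amp_add _ _).symm
      map_smul' := fun c ψ => amp_ext <| (hT _).trans <| (hsmul c ψ).trans <|
        ((hT ψ).const_smul c).symm.trans (amp_smul c _).symm }
  have hL (ψ : Fock n) : ‖L ψ‖ ≤ C * ‖ψ‖ := by
    refine norm_le_of_lintegral_le (le_trans (le_of_eq (lintegral_congr_ae ?_)) (hbound ψ))
    filter_upwards [hT ψ] with k hk
    simp only [L, LinearMap.coe_mk, AddHom.coe_mk, hk]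
  exact ⟨L.mkContinuous C hL, L.mkContinuous_norm_le C.2 hL, hT⟩

end States

/-! ### Hilbert–Schmidt kernels acting on one momentum -/

theorem integral_kernel_mul_conj_comm {α 𝕜 : Type*} [MeasurableSpace α] {μ : Measure α} [SFinite μ]
    [RCLike 𝕜] {N : α → α → 𝕜} (hN : MemLp (Function.uncurry N) 2 (μ.prod μ))
    (hsymm : ∀ᵐ x ∂μ, ∀ᵐ y ∂μ, (starRingEnd 𝕜) (N y x) = N x y) {f g : α → 𝕜}
    (hf : MemLp f 2 μ) (hg : MemLp g 2 μ) :
    ∫ x, (∫ y, N x y * f y ∂μ) * (starRingEnd 𝕜) (g x) ∂μ =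
      ∫ x, f x * (starRingEnd 𝕜) (∫ y, N x y * g y ∂μ) ∂μ := by
  have hfg : MemLp (fun q : α × α => (starRingEnd 𝕜) (g q.1) * f q.2) 2 (μ.prod μ) := by
    refine (memLp_two_iff_lintegral_enorm_sq_lt_top (hg.1.star.comp_fst.mul hf.1.comp_snd)).2 ?_
    calc _ = ∫⁻ q, ‖g q.1‖ₑ ^ 2 * ‖f q.2‖ₑ ^ 2 ∂μ.prod μ := by
          simp only [Pi.mul_apply, Pi.star_apply, RCLike.star_def, enorm_mul, mul_pow,
            RCLike.enorm_conj]
      _ = (∫⁻ x, ‖g x‖ₑ ^ 2 ∂μ) * ∫⁻ y, ‖f y‖ₑ ^ 2 ∂μ :=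
          lintegral_prod_mul (hg.1.enorm.pow_const 2) (hf.1.enorm.pow_const 2)
      _ < ⊤ := ENNReal.mul_lt_top ((memLp_two_iff_lintegral_enorm_sq_lt_top hg.1).1 hg)
          ((memLp_two_iff_lintegral_enorm_sq_lt_top hf.1).1 hf)
  have hint : Integrable (Function.uncurry fun x y => N x y * ((starRingEnd 𝕜) (g x) * f y))
      (μ.prod μ) := hN.integrable_mul hfg
  calc _ = ∫ x, ∫ y, N x y * ((starRingEnd 𝕜) (g x) * f y) ∂μ ∂μ := by
        simp only [← integral_mul_const]
        simp only [mul_assoc, mul_comm]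
    _ = ∫ y, ∫ x, N x y * ((starRingEnd 𝕜) (g x) * f y) ∂μ ∂μ := integral_integral_swap hint
    _ = _ := by
        simp only [← integral_conj, ← integral_const_mul]
        refine integral_congr_ae ?_
        filter_upwards [hsymm] with y hy
        refine integral_congr_ae ?_
        filter_upwards [hy] with x hx
        rw [← hx, map_mul]
        simp only [RCLike.conj_conj]
        ring

theorem integrable_mul_conj {α 𝕜 : Type*} [MeasurableSpace α] {μ : Measure α} [RCLike 𝕜]
    {f g : α → 𝕜} (hf : MemLp f 2 μ) (hg : MemLp g 2 μ) :
    Integrable (fun a => f a * (starRingEnd 𝕜) (g a)) μ :=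
  hf.integrable_mul hg.star

theorem ae_of_ae_insertNth {n : ℕ} (i : Fin (n + 1)) {P : (Fin (n + 1) → ℝ × ℝ) → Prop}
    (hP : MeasurableSet {k | P k})
    (h : ∀ᵐ r ∂nMeasure n, ∀ᵐ p ∂momentumMeasure, P (i.insertNth p r)) :
    ∀ᵐ k ∂nMeasure (n + 1), P k := by
  have hprod : ∀ᵐ q ∂(nMeasure n).prod momentumMeasure, P (i.insertNth q.2 q.1) :=
    (Measure.ae_prod_iff_ae_ae (((measurable_insertNth i).comp measurable_swap) hP)).2 h
  rw [← (measurePreserving_insertNth n i).map_eq,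
    ae_map_iff (measurable_insertNth i).aemeasurable hP]
  exact Measure.measurePreserving_swap.quasiMeasurePreserving.ae hprod

/-- The kernel `N k y`, which replaces the momentum `kᵢ` by `y`, is Hilbert–Schmidt in `(kᵢ, y)`
with norm at most `C`, uniformly in the other (positive) momenta. -/
structure IsHSKernel {n : ℕ} (i : Fin n) (N : (Fin n → ℝ × ℝ) → ℝ × ℝ → ℂ) (C : NNReal) :
    Prop where
  measurable : Measurable (Function.uncurry N)
  lintegral_le : ∀ k : Fin n → ℝ × ℝ, (∀ j, 0 < (k j).1) →
    ∫⁻ x, ∫⁻ y, ‖N (Function.update k i x) y‖ₑ ^ 2 ∂momentumMeasure ∂momentumMeasure ≤ C ^ 2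

namespace IsHSKernel

section

variable {n : ℕ} {i : Fin n} {N : (Fin n → ℝ × ℝ) → ℝ × ℝ → ℂ} {C : NNReal}

theorem measurable_integral (h : IsHSKernel i N C) {f : (Fin n → ℝ × ℝ) → ℂ} (hf : Measurable f) :
    Measurable fun k => ∫ y, N k y * f (Function.update k i y) ∂momentumMeasure :=
  (StronglyMeasurable.integral_prod_right (f := fun k y => N k y * f (Function.update k i y))
    (h.measurable.mul (hf.comp measurable_update')).stronglyMeasurable).measurable

end

section InsertNth

variable {n : ℕ} {i : Fin (n + 1)} {N : (Fin (n + 1) → ℝ × ℝ) → ℝ × ℝ → ℂ} {C : NNReal}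

theorem measurable_insertNth (h : IsHSKernel i N C) (r : Fin n → ℝ × ℝ) :
    Measurable (Function.uncurry fun x y => N (i.insertNth x r) y) :=
  h.measurable.comp ((((LightFrontLee.measurable_insertNth i).comp
    measurable_prodMk_right).comp measurable_fst).prodMk measurable_snd)

theorem lintegral_insertNth_le (h : IsHSKernel i N C) {r : Fin n → ℝ × ℝ}
    (hr : ∀ j, 0 < (r j).1) :
    ∫⁻ x, ∫⁻ y, ‖N (i.insertNth x r) y‖ₑ ^ 2 ∂momentumMeasure ∂momentumMeasure ≤ C ^ 2 := by
  simpa only [Fin.update_insertNth] using h.lintegral_le (i.insertNth (1, 0) r)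
    ((Fin.forall_iff_succAbove i).2 ⟨by simp, by simpa using hr⟩)

end InsertNth

variable {n : ℕ} {i : Fin n} {N : (Fin n → ℝ × ℝ) → ℝ × ℝ → ℂ} {C : NNReal}

theorem ae_memLp (h : IsHSKernel i N C) : ∀ᵐ k ∂nMeasure n, MemLp (N k) 2 momentumMeasure := by
  cases n with
  | zero => exact i.elim0
  | succ n =>
    have hfin : ∀ᵐ k ∂nMeasure (n + 1), ∫⁻ y, ‖N k y‖ₑ ^ 2 ∂momentumMeasure < ⊤ := by
      refine ae_of_ae_insertNth i (measurableSet_lt (Measurable.lintegral_prod_right'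
        (f := fun q => ‖Function.uncurry N q‖ₑ ^ 2) (h.measurable.enorm.pow_const 2))
        measurable_const) ?_
      filter_upwards [ae_momenta_pos n] with r hr
      exact ae_lt_top (Measurable.lintegral_prod_right'
        (f := fun q : (ℝ × ℝ) × (ℝ × ℝ) => ‖N (i.insertNth q.1 r) q.2‖ₑ ^ 2)
        ((h.measurable_insertNth r).enorm.pow_const 2))
        ((h.lintegral_insertNth_le hr).trans_lt (by simp)).ne
    filter_upwards [hfin] with k hk
    exact (memLp_two_iff_lintegral_enorm_sq_lt_top
      (h.measurable.comp measurable_prodMk_left).aestronglyMeasurable).2 hk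

theorem lintegral_integral_sq_le (h : IsHSKernel i N C) {f : (Fin n → ℝ × ℝ) → ℂ}
    (hf : Measurable f) :
    ∫⁻ k, ‖∫ y, N k y * f (Function.update k i y) ∂momentumMeasure‖ₑ ^ 2 ∂nMeasure n ≤
      C ^ 2 * ∫⁻ k, ‖f k‖ₑ ^ 2 ∂nMeasure n := by
  cases n with
  | zero => exact i.elim0
  | succ n =>
    have hins : Measurable fun q : (Fin n → ℝ × ℝ) × (ℝ × ℝ) =>
        (i.insertNth q.2 q.1 : Fin (n + 1) → ℝ × ℝ) :=
      (LightFrontLee.measurable_insertNth i).comp measurable_swap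
    have hf2 : Measurable fun k => ‖f k‖ₑ ^ 2 := by fun_prop
    have hslice : Measurable fun r : Fin n → ℝ × ℝ =>
        ∫⁻ p, ‖f (i.insertNth p r)‖ₑ ^ 2 ∂momentumMeasure :=
      (hf2.comp hins).lintegral_prod_right'
    rw [lintegral_insertNth i ((h.measurable_integral hf).enorm.pow_const 2),
      lintegral_insertNth i hf2, ← lintegral_const_mul _ hslice]
    refine lintegral_mono_ae ?_
    filter_upwards [ae_momenta_pos n] with r hr
    have hNr := h.measurable_insertNth r
    have hfr : Measurable fun y => f (i.insertNth y r) :=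
      hf.comp (hins.comp measurable_prodMk_left)
    calc _ ≤ ∫⁻ x, (∫⁻ y, ‖N (i.insertNth x r) y‖ₑ ^ 2 ∂momentumMeasure) *
          ∫⁻ y, ‖f (i.insertNth y r)‖ₑ ^ 2 ∂momentumMeasure ∂momentumMeasure := by
          refine lintegral_mono fun x => ?_
          simp only [Fin.update_insertNth]
          exact enorm_integral_mul_sq_le
            (hNr.comp measurable_prodMk_left).aestronglyMeasurable hfr.aestronglyMeasurable
      _ ≤ _ := by
          have hrow : Measurable fun x => ∫⁻ y, ‖N (i.insertNth x r) y‖ₑ ^ 2 ∂momentumMeasure :=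
            (hNr.enorm.pow_const 2).lintegral_prod_right'
          rw [lintegral_mul_const _ hrow]
          gcongr
          exact h.lintegral_insertNth_le hr

theorem memLp_integral (h : IsHSKernel i N C) (ψ : Fock n) :
    MemLp (fun k => ∫ y, N k y * amp ψ (Function.update k i y) ∂momentumMeasure) 2 (nMeasure n) :=
  (memLp_two_iff_lintegral_enorm_sq_lt_top
    (h.measurable_integral (measurable_amp ψ)).aestronglyMeasurable).2 <|
    (h.lintegral_integral_sq_le (measurable_amp ψ)).trans_lt <| ENNReal.mul_lt_top (by simp) <|
      (memLp_two_iff_lintegral_enorm_sq_lt_top (memLp_amp ψ).1).1 (memLp_amp ψ)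

theorem integral_mul_conj_comm (h : IsHSKernel i N C)
    (hsymm : ∀ k : Fin n → ℝ × ℝ, (∀ j, 0 < (k j).1) → ∀ p : ℝ × ℝ, 0 < p.1 →
      (starRingEnd ℂ) (N (Function.update k i p) (k i)) = N k p) (φ ψ : Fock n) :
    ∫ k, (∫ y, N k y * amp ψ (Function.update k i y) ∂momentumMeasure) *
        (starRingEnd ℂ) (amp φ k) ∂nMeasure n =
      ∫ k, amp ψ k * (starRingEnd ℂ)
        (∫ y, N k y * amp φ (Function.update k i y) ∂momentumMeasure) ∂nMeasure n := by
  cases n with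
  | zero => exact i.elim0
  | succ n =>
    rw [integral_insertNth i (integrable_mul_conj (h.memLp_integral ψ) (memLp_amp φ)),
      integral_insertNth i (integrable_mul_conj (memLp_amp ψ) (h.memLp_integral φ))]
    refine integral_congr_ae ?_
    filter_upwards [ae_momenta_pos n, ae_memLp_insertNth i (measurable_amp ψ) (memLp_amp ψ),
      ae_memLp_insertNth i (measurable_amp φ) (memLp_amp φ)] with r hr hψ hφ
    simp only [Fin.update_insertNth]
    have hNr := h.measurable_insertNth r
    refine integral_kernel_mul_conj_comm
      ((memLp_two_iff_lintegral_enorm_sq_lt_top hNr.aestronglyMeasurable).2 ?_) ?_ hψ hφ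
    · rw [lintegral_prod _ (hNr.enorm.pow_const 2).aemeasurable]
      exact (h.lintegral_insertNth_le hr).trans_lt (by simp)
    · filter_upwards [ae_momentum_pos] with x hx
      filter_upwards [ae_momentum_pos] with y hy
      simpa using hsymm (i.insertNth x r)
        ((Fin.forall_iff_succAbove i).2 ⟨by simpa using hx, by simpa using hr⟩) y hy

end IsHSKernel

/-! ### Multiplication and exchange operators -/

section MultiplicationOperators

variable {m : ℝ} {n : ℕ} {s : ℝ → ℂ}

theorem exists_clm_funH0 (hs : Measurable s) {C : NNReal}
    (hsC : ∀ h : ℝ, n * m ≤ h → ‖s h‖ ≤ C) :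
    ∃ T : Fock n →L[ℂ] Fock n,
      ∀ ψ, amp (T ψ) =ᵐ[nMeasure n] fun k => s (freeEnergy m k) * amp ψ k := by
  have hmul (ψ : Fock n) : Measurable fun k => s (freeEnergy m k) * amp ψ k :=
    (hs.comp (measurable_freeEnergy m n)).mul (measurable_amp ψ)
  obtain ⟨T, -, hT⟩ := exists_clm_amp_ae_eq (F := fun ψ k => s (freeEnergy m k) * amp ψ k) (C := C)
    (fun ψ χ => by
      filter_upwards [amp_add ψ χ] with k hk
      simp only [hk, Pi.add_apply, mul_add])
    (fun c ψ => by
      filter_upwards [amp_smul c ψ] with k hk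
      simp only [hk, Pi.smul_apply, smul_eq_mul, mul_left_comm])
    (fun ψ => (hmul ψ).aestronglyMeasurable)
    (fun ψ σ => by
      filter_upwards [ae_amp_comp_perm ψ σ] with k hk
      rw [freeEnergy_comp_perm, hk])
    fun ψ => by
      rw [← lintegral_const_mul _ ((measurable_amp ψ).enorm.pow_const 2)]
      refine lintegral_mono_ae ?_
      filter_upwards [ae_le_freeEnergy m n] with k hk
      rw [enorm_mul, mul_pow]
      gcongr
      rw [enorm_eq_nnnorm, ENNReal.coe_le_coe]
      exact hsC _ hk
  exact ⟨T, hT⟩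

theorem isSelfAdjoint_of_amp_eq_mul {T : Fock n →L[ℂ] Fock n}
    (hT : ∀ ψ, amp (T ψ) =ᵐ[nMeasure n] fun k => s (freeEnergy m k) * amp ψ k)
    (hs : ∀ h : ℝ, n * m ≤ h → (starRingEnd ℂ) (s h) = s h) : IsSelfAdjoint T := by
  refine ContinuousLinearMap.isSelfAdjoint_iff_isSymmetric.2 fun φ ψ => ?_
  change inner ℂ (T φ) ψ = inner ℂ φ (T ψ)
  rw [inner_eq_integral, inner_eq_integral]
  refine integral_congr_ae ?_
  filter_upwards [hT φ, hT ψ, ae_le_freeEnergy m n] with k hφ hψ hk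
  rw [hφ, hψ, map_mul, hs _ hk]
  ring

end MultiplicationOperators

section Exchange

variable {n : ℕ} {N : Fin n → (Fin n → ℝ × ℝ) → ℝ × ℝ → ℂ} {C : NNReal}

/-- The function `k ↦ ∑ᵢ ∫ Nᵢ(k, y) f(k₁, …, y, …, kₙ) dκ(y)`, with `y` in the `i`-th place: each
boson in turn exchanges its momentum through the kernel `Nᵢ`. -/
def exchange (N : Fin n → (Fin n → ℝ × ℝ) → ℝ × ℝ → ℂ) (f : (Fin n → ℝ × ℝ) → ℂ)
    (k : Fin n → ℝ × ℝ) : ℂ :=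
  ∑ i, ∫ y, N i k y * f (Function.update k i y) ∂momentumMeasure

theorem lintegral_sum_sq_le {α E ι : Type*} [MeasurableSpace α] {μ : Measure α}
    [NormedAddCommGroup E] [Fintype ι] {g : ι → α → E} (hg : ∀ i, AEStronglyMeasurable (g i) μ)
    {A : ENNReal} (h : ∀ i, ∫⁻ a, ‖g i a‖ₑ ^ 2 ∂μ ≤ A ^ 2) :
    ∫⁻ a, ‖∑ i, g i a‖ₑ ^ 2 ∂μ ≤ (Fintype.card ι * A) ^ 2 := by
  have hle (i : ι) : eLpNorm (g i) 2 μ ≤ A := by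
    rw [← ENNReal.pow_le_pow_left_iff two_ne_zero, eLpNorm_two_sq]
    exact h i
  rw [← eLpNorm_two_sq, ← Finset.sum_fn]
  gcongr
  refine (eLpNorm_sum_le (fun i _ => hg i) (by norm_num)).trans
    ((Finset.sum_le_sum fun i _ => hle i).trans ?_)
  simp

theorem ae_integrable_exchange (hN : ∀ i, IsHSKernel i (N i) C) (ψ : Fock n) :
    ∀ᵐ k ∂nMeasure n, ∀ i,
      Integrable (fun y => N i k y * amp ψ (Function.update k i y)) momentumMeasure := by
  refine ae_all_iff.2 fun i => ?_
  filter_upwards [(hN i).ae_memLp, ae_memLp_update i ψ] with k hNk hψ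
  exact hNk.integrable_mul hψ

theorem exchange_amp_add (hN : ∀ i, IsHSKernel i (N i) C) (ψ χ : Fock n) :
    exchange N (amp (ψ + χ)) =ᵐ[nMeasure n] exchange N (amp ψ) + exchange N (amp χ) := by
  filter_upwards [ae_integrable_exchange hN ψ, ae_integrable_exchange hN χ,
    ae_all_iff.2 fun i => ae_update i (amp_add ψ χ)] with k hψ hχ hk
  simp only [exchange, Pi.add_apply, ← Finset.sum_add_distrib]
  refine Finset.sum_congr rfl fun i _ => ?_
  rw [← integral_add (hψ i) (hχ i)]
  refine integral_congr_ae ?_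
  filter_upwards [hk i] with y hy
  rw [hy, Pi.add_apply, mul_add]

theorem exchange_amp_smul (c : ℂ) (ψ : Fock n) :
    exchange N (amp (c • ψ)) =ᵐ[nMeasure n] c • exchange N (amp ψ) := by
  filter_upwards [ae_all_iff.2 fun i => ae_update i (amp_smul c ψ)] with k hk
  simp only [exchange, Pi.smul_apply, smul_eq_mul, Finset.mul_sum, ← integral_const_mul]
  refine Finset.sum_congr rfl fun i _ => integral_congr_ae ?_
  filter_upwards [hk i] with y hy
  rw [hy, Pi.smul_apply, smul_eq_mul, mul_left_comm]

theorem exchange_amp_comp_perm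
    (hperm : ∀ (σ : Equiv.Perm (Fin n)) i k y, N i (k ∘ σ) y = N (σ i) k y) (ψ : Fock n)
    (σ : Equiv.Perm (Fin n)) :
    ∀ᵐ k ∂nMeasure n, exchange N (amp ψ) (k ∘ σ) = exchange N (amp ψ) k := by
  filter_upwards [ae_all_iff.2 fun i => ae_update i (ae_amp_comp_perm ψ σ)] with k hk
  unfold exchange
  rw [← Equiv.sum_comp σ fun i => ∫ y, N i k y * amp ψ (Function.update k i y) ∂momentumMeasure]
  refine Finset.sum_congr rfl fun i _ => integral_congr_ae ?_
  filter_upwards [hk (σ i)] with y hy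
  rw [hperm, update_comp_perm, hy]

theorem exists_clm_exchange (hN : ∀ i, IsHSKernel i (N i) C)
    (hperm : ∀ (σ : Equiv.Perm (Fin n)) i k y, N i (k ∘ σ) y = N (σ i) k y) :
    ∃ T : Fock n →L[ℂ] Fock n,
      ‖T‖ ≤ n * C ∧ ∀ ψ, amp (T ψ) =ᵐ[nMeasure n] exchange N (amp ψ) := by
  have hmeas (ψ : Fock n) (i : Fin n) := (hN i).measurable_integral (measurable_amp ψ)
  have hbound (ψ : Fock n) : ∫⁻ k, ‖exchange N (amp ψ) k‖ₑ ^ 2 ∂nMeasure n ≤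
      ((n * C : NNReal) : ENNReal) ^ 2 * ∫⁻ k, ‖amp ψ k‖ₑ ^ 2 ∂nMeasure n := by
    have h := lintegral_sum_sq_le (A := C * ‖ψ‖ₑ) (fun i => (hmeas ψ i).aestronglyMeasurable)
      fun i => by
        rw [mul_pow, enorm_sq_eq_lintegral]
        exact (hN i).lintegral_integral_sq_le (measurable_amp ψ)
    rwa [Fintype.card_fin, ← mul_assoc, mul_pow, enorm_sq_eq_lintegral] at h
  obtain ⟨T, hnorm, hT⟩ := exists_clm_amp_ae_eq (exchange_amp_add hN) exchange_amp_smul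
    (fun ψ => (Finset.measurable_sum _ fun i _ => hmeas ψ i).aestronglyMeasurable)
    (exchange_amp_comp_perm hperm) hbound
  exact ⟨T, by simpa using hnorm, hT⟩

theorem isSelfAdjoint_of_amp_eq_exchange (hN : ∀ i, IsHSKernel i (N i) C)
    (hsymm : ∀ i (k : Fin n → ℝ × ℝ), (∀ j, 0 < (k j).1) → ∀ p : ℝ × ℝ, 0 < p.1 →
      (starRingEnd ℂ) (N i (Function.update k i p) (k i)) = N i k p)
    {T : Fock n →L[ℂ] Fock n} (hT : ∀ ψ, amp (T ψ) =ᵐ[nMeasure n] exchange N (amp ψ)) :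
    IsSelfAdjoint T := by
  refine ContinuousLinearMap.isSelfAdjoint_iff_isSymmetric.2 fun φ ψ => ?_
  change inner ℂ (T φ) ψ = inner ℂ φ (T ψ)
  rw [inner_eq_integral, inner_eq_integral]
  calc _ = ∫ k, ∑ i, amp ψ k * (starRingEnd ℂ)
          (∫ y, N i k y * amp φ (Function.update k i y) ∂momentumMeasure) ∂nMeasure n := by
        refine integral_congr_ae ?_
        filter_upwards [hT φ] with k hk
        rw [hk, exchange, map_sum, Finset.mul_sum]
    _ = ∑ i, ∫ k, amp ψ k * (starRingEnd ℂ)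
          (∫ y, N i k y * amp φ (Function.update k i y) ∂momentumMeasure) ∂nMeasure n :=
        integral_finsetSum _ fun i _ =>
          integrable_mul_conj (memLp_amp ψ) ((hN i).memLp_integral φ)
    _ = ∑ i, ∫ k, (∫ y, N i k y * amp ψ (Function.update k i y) ∂momentumMeasure) *
          (starRingEnd ℂ) (amp φ k) ∂nMeasure n :=
        Finset.sum_congr rfl fun i _ => ((hN i).integral_mul_conj_comm (hsymm i) φ ψ).symm
    _ = ∫ k, ∑ i, (∫ y, N i k y * amp ψ (Function.update k i y) ∂momentumMeasure) *
          (starRingEnd ℂ) (amp φ k) ∂nMeasure n :=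
        (integral_finsetSum _ fun i _ =>
          integrable_mul_conj ((hN i).memLp_integral ψ) (memLp_amp φ)).symm
    _ = _ := by
        refine integral_congr_ae ?_
        filter_upwards [hT ψ] with k hk
        rw [hk, exchange, Finset.sum_mul]

end Exchange

theorem freeEnergy_update (m : ℝ) {n : ℕ} (k : Fin n → ℝ × ℝ) (i : Fin n) (p : ℝ × ℝ) :
    freeEnergy m (Function.update k i p) = omega m p + (freeEnergy m k - omega m (k i)) := by
  have h (q : Fin n → ℝ × ℝ) :
      freeEnergy m q = omega m (q i) + ∑ j ∈ Finset.univ.erase i, omega m (q j) :=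
    (Finset.add_sum_erase _ (fun j => omega m (q j)) (Finset.mem_univ i)).symm
  rw [h, h k, Function.update_self, add_sub_cancel_left]
  congr 1
  exact Finset.sum_congr rfl fun j hj => by
    rw [Function.update_of_ne (Finset.ne_of_mem_erase hj)]

theorem le_freeEnergy_sub (m : ℝ) {n : ℕ} {k : Fin n → ℝ × ℝ} (hk : ∀ i, 0 < (k i).1)
    (i : Fin n) : m * ((n : ℝ) - 1) ≤ freeEnergy m k - omega m (k i) := by
  have h := Finset.card_nsmul_le_sum (Finset.univ.erase i) (fun j => omega m (k j)) m
    fun j _ => le_omega (hk j)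
  rw [Finset.sum_erase_eq_sub (Finset.mem_univ i), Finset.card_erase_of_mem (Finset.mem_univ i),
    Finset.card_univ, Fintype.card_fin, nsmul_eq_mul, Nat.cast_pred i.pos, mul_comm] at h
  exact h

/-! ### The kinetic part -/

section KineticSymbol

variable {m mu lam : ℝ}

theorem measurable_kineticSymbol (m mu lam : ℝ) (E : ℂ) :
    Measurable (kineticSymbol m mu lam E) := by
  have hm := measurable_omega m
  have hint : StronglyMeasurable fun h : ℝ =>
      ∫ k, (1 / ((omega m k : ℂ) - mu) - 1 / ((h : ℂ) - E + omega m k)) ∂momentumMeasure :=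
    StronglyMeasurable.integral_prod_right (f := fun (h : ℝ) k =>
      (1 / ((omega m k : ℂ) - mu) - 1 / ((h : ℂ) - E + omega m k)))
      (Measurable.stronglyMeasurable (by unfold Function.uncurry; fun_prop))
  have hint' := hint.measurable
  unfold kineticSymbol
  fun_prop

theorem exists_kineticSymbol_eq (lam : ℝ) (hmu : mu < m) {E h : ℝ} (hh : 0 < h - E + mu) :
    ∃ x : ℝ, h - E + mu ≤ x ∧ kineticSymbol m mu lam E h = x := by
  refine ⟨(h - E + mu) + lam ^ 2 * ∫ k, (1 / (omega m k - mu) - 1 / (h - E + omega m k))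
    ∂momentumMeasure, ?_, ?_⟩
  · refine le_add_of_nonneg_right (mul_nonneg (sq_nonneg _) (integral_nonneg_of_ae ?_))
    filter_upwards [ae_le_omega m] with k hk
    exact sub_nonneg.2 (one_div_le_one_div_of_le (by linarith) (by linarith))
  · rw [kineticSymbol]
    push_cast
    congr 2
    rw [← integral_complex_ofReal]
    push_cast
    rfl

/-- The symbol `κ_E(h)^{-1/2}` of `K(E)^{-1/2}`, where `κ_E` is the symbol of `K(E)`. -/
def invSqrtSymbol (m mu lam : ℝ) (E : ℂ) (h : ℝ) : ℂ :=
  kineticSymbol m mu lam E h ^ (-(1 / 2) : ℂ)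

theorem measurable_invSqrtSymbol (m mu lam : ℝ) (E : ℂ) :
    Measurable (invSqrtSymbol m mu lam E) :=
  (measurable_kineticSymbol m mu lam E).pow_const _

theorem conj_invSqrtSymbol (lam : ℝ) (hmu : mu < m) {E h : ℝ} (hh : 0 < h - E + mu) :
    (starRingEnd ℂ) (invSqrtSymbol m mu lam E h) = invSqrtSymbol m mu lam E h := by
  obtain ⟨x, hx, hκ⟩ := exists_kineticSymbol_eq lam hmu hh
  have hcast : (-(1 / 2) : ℂ) = ((-(1 / 2) : ℝ) : ℂ) := by norm_num
  rw [invSqrtSymbol, hκ, hcast, ← Complex.ofReal_cpow (hh.le.trans hx), Complex.conj_ofReal]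

theorem kineticSymbol_mul_invSqrtSymbol_sq (lam : ℝ) (hmu : mu < m) {E h : ℝ}
    (hh : 0 < h - E + mu) :
    kineticSymbol m mu lam E h * invSqrtSymbol m mu lam E h ^ 2 = 1 := by
  obtain ⟨x, hx, hκ⟩ := exists_kineticSymbol_eq lam hmu hh
  have hκ0 : kineticSymbol m mu lam E h ≠ 0 := by
    rw [hκ]
    exact Complex.ofReal_ne_zero.2 (hh.trans_le hx).ne'
  rw [invSqrtSymbol, ← Complex.cpow_nat_mul, show ((2 : ℕ) : ℂ) * -(1 / 2) = -1 by norm_num,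
    Complex.cpow_neg_one, mul_inv_cancel₀ hκ0]

theorem norm_invSqrtSymbol_sq_le (lam : ℝ) (hmu : mu < m) {E h : ℝ} (hh : 0 < h - E + mu) :
    ‖invSqrtSymbol m mu lam E h‖ ^ 2 ≤ (h - E + mu)⁻¹ := by
  obtain ⟨x, hx, hκ⟩ := exists_kineticSymbol_eq lam hmu hh
  have hmul := congrArg norm (kineticSymbol_mul_invSqrtSymbol_sq lam hmu hh)
  rw [norm_mul, norm_pow, norm_one, hκ, Complex.norm_real,
    Real.norm_of_nonneg (hh.le.trans hx)] at hmul
  rw [eq_inv_of_mul_eq_one_right hmul]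
  exact inv_anti₀ hh hx

theorem mem_graph_kineticOp_iff {n : ℕ} (hm : 0 < m) (hmu : mu < m) {E : ℝ}
    (hE : E < m * ((n : ℝ) - 1) + mu) {S : Fock n →L[ℂ] Fock n}
    (hS : ∀ ψ, amp (S ψ) =ᵐ[nMeasure n]
      fun k => invSqrtSymbol m mu lam E (freeEnergy m k) * amp ψ k) (x y : Fock n) :
    (x, y) ∈ (kineticOp m mu lam n E).graph ↔ S (S y) = x := by
  have hSS : amp (S (S y)) =ᵐ[nMeasure n]
      fun k => invSqrtSymbol m mu lam E (freeEnergy m k) ^ 2 * amp y k := by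
    filter_upwards [hS (S y), hS y] with k h₁ h₂
    rw [h₁, h₂, sq, mul_assoc]
  have hone : ∀ᵐ k ∂nMeasure n, kineticSymbol m mu lam E (freeEnergy m k) *
      invSqrtSymbol m mu lam E (freeEnergy m k) ^ 2 = 1 := by
    filter_upwards [ae_le_freeEnergy m n] with k hk
    exact kineticSymbol_mul_invSqrtSymbol_sq lam hmu (by linarith)
  rw [kineticOp, mem_graph_funH0]
  constructor
  · intro h
    refine amp_ext ?_
    filter_upwards [h, hSS, hone] with k hy h₂ h₁
    rw [h₂, hy]
    linear_combination amp x k * h₁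
  · rintro rfl
    filter_upwards [hSS, hone] with k h₂ h₁
    rw [h₂]
    linear_combination -amp y k * h₁

end KineticSymbol

/-! ### The potential relative to the kinetic part -/

section DoubleIntegrals

variable {m c : ℝ}

theorem lintegral_lintegral_inv_sq_mul_inv_le (hm : 0 < m) (hc : 0 < c) :
    ∫⁻ x, ∫⁻ y, ENNReal.ofReal (((omega m x + (omega m y + 2 * c)) ^ 2)⁻¹ * (omega m y + c)⁻¹)
      ∂momentumMeasure ∂momentumMeasure ≤
      ENNReal.ofReal (1 / (4 * Real.pi) * (1 / (4 * Real.pi * c))) := by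
  have hmeas := measurable_omega m
  calc
    _ = ∫⁻ y, ∫⁻ x, ENNReal.ofReal (((omega m x + (omega m y + 2 * c)) ^ 2)⁻¹ *
          (omega m y + c)⁻¹) ∂momentumMeasure ∂momentumMeasure :=
        lintegral_lintegral_swap (Measurable.aemeasurable (by unfold Function.uncurry; fun_prop))
    _ ≤ ∫⁻ y, ENNReal.ofReal (1 / (4 * Real.pi)) * ENNReal.ofReal (((omega m y + c) ^ 2)⁻¹)
          ∂momentumMeasure := by
        refine lintegral_mono_ae ?_
        filter_upwards [ae_le_omega m] with y hy
        have hY : 0 < omega m y + c := by linarith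
        have hY' : 0 < omega m y + 2 * c := by linarith
        simp only [ENNReal.ofReal_mul (inv_nonneg.2 (sq_nonneg _))]
        rw [lintegral_mul_const _ (by fun_prop)]
        refine (mul_le_mul_left (lintegral_inv_omega_add_sq_le m hY') _).trans ?_
        rw [← ENNReal.ofReal_mul (by positivity), ← ENNReal.ofReal_mul (by positivity)]
        refine ENNReal.ofReal_le_ofReal ?_
        calc _ ≤ 1 / (4 * Real.pi * (omega m y + c)) * (omega m y + c)⁻¹ := by
              gcongr
              linarith
          _ = _ := by field_simp
    _ ≤ _ := by
        rw [lintegral_const_mul _ (by fun_prop), ENNReal.ofReal_mul (by positivity)]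
        gcongr
        exact lintegral_inv_omega_add_sq_le m hc

theorem lintegral_lintegral_inv_sq_mul_inv_sq_le (m : ℝ) (hc : 0 < c) :
    ∫⁻ x, ∫⁻ y, ENNReal.ofReal (((omega m x + c) ^ 2)⁻¹ * ((omega m y + c) ^ 2)⁻¹)
      ∂momentumMeasure ∂momentumMeasure ≤ ENNReal.ofReal ((1 / (4 * Real.pi * c)) ^ 2) := by
  have hmeas := measurable_omega m
  simp only [ENNReal.ofReal_mul (inv_nonneg.2 (sq_nonneg _))]
  rw [lintegral_lintegral_mul (by fun_prop) (by fun_prop), ENNReal.ofReal_pow (by positivity), sq]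
  gcongr <;> exact lintegral_inv_omega_add_sq_le m hc

end DoubleIntegrals

/-- The kernel of `t(H₀) U(E) s(H₀)` for the `i`-th boson, see `exchange`. -/
def exchangeKernel (m lam : ℝ) {n : ℕ} (E : ℂ) (t s : ℝ → ℂ) (i : Fin n) (k : Fin n → ℝ × ℝ)
    (p : ℝ × ℝ) : ℂ :=
  t (freeEnergy m k) * ((lam : ℂ) ^ 2 * ((freeEnergy m k : ℂ) - E + omega m p)⁻¹) *
    s (freeEnergy m (Function.update k i p))

section ExchangeKernel

variable {m mu lam E : ℝ} {n : ℕ} {t s : ℝ → ℂ}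

theorem measurable_exchangeKernel (m lam : ℝ) {n : ℕ} (E : ℂ) (ht : Measurable t)
    (hs : Measurable s) (i : Fin n) :
    Measurable (Function.uncurry (exchangeKernel m lam E t s i)) := by
  have hk : Measurable fun q : (Fin n → ℝ × ℝ) × (ℝ × ℝ) => freeEnergy m q.1 :=
    (measurable_freeEnergy m n).comp measurable_fst
  have hp : Measurable fun q : (Fin n → ℝ × ℝ) × (ℝ × ℝ) => omega m q.2 :=
    (measurable_omega m).comp measurable_snd
  have hu : Measurable fun q : (Fin n → ℝ × ℝ) × (ℝ × ℝ) =>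
      freeEnergy m (Function.update q.1 i q.2) :=
    (measurable_freeEnergy m n).comp measurable_update'
  unfold exchangeKernel Function.uncurry
  fun_prop

theorem exchangeKernel_update (i : Fin n) (k : Fin n → ℝ × ℝ) (x y : ℝ × ℝ) :
    exchangeKernel m lam E t s i (Function.update k i x) y =
      t (omega m x + (freeEnergy m k - omega m (k i))) *
        ((lam : ℂ) ^ 2 *
          ((omega m x + omega m y + (freeEnergy m k - omega m (k i)) - E : ℝ) : ℂ)⁻¹) *
        s (omega m y + (freeEnergy m k - omega m (k i))) := by
  simp only [exchangeKernel, Function.update_idem, freeEnergy_update]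
  congr 4
  push_cast
  ring

theorem exchangeKernel_comp_perm (E : ℂ) (σ : Equiv.Perm (Fin n)) (i : Fin n)
    (k : Fin n → ℝ × ℝ) (y : ℝ × ℝ) :
    exchangeKernel m lam E t s i (k ∘ σ) y = exchangeKernel m lam E t s (σ i) k y := by
  simp only [exchangeKernel, update_comp_perm, freeEnergy_comp_perm]

theorem conj_exchangeKernel_update (hs : ∀ h : ℝ, n * m ≤ h → (starRingEnd ℂ) (s h) = s h)
    (i : Fin n) (k : Fin n → ℝ × ℝ) (hk : ∀ j, 0 < (k j).1) (p : ℝ × ℝ)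
    (hp : 0 < p.1) :
    (starRingEnd ℂ) (exchangeKernel m lam E s s i (Function.update k i p) (k i)) =
      exchangeKernel m lam E s s i k p := by
  have hr := le_freeEnergy_sub m hk i
  have hki := le_omega (m := m) (hk i)
  have hpm := le_omega (m := m) hp
  conv_rhs => rw [← Function.update_eq_self i k]
  rw [exchangeKernel_update, exchangeKernel_update]
  simp only [map_mul, map_pow, map_inv₀, Complex.conj_ofReal]
  rw [hs _ (by linarith), hs _ (by linarith), add_comm (omega m (k i)) (omega m p)]
  ring

theorem norm_exchangeFactor_sq_le (lam : ℝ) {c d : ℝ} (hc : 0 < c) (hd : c ≤ d) :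
    ‖(lam : ℂ) ^ 2 * ((d : ℝ) : ℂ)⁻¹‖ ^ 2 ≤ lam ^ 4 * (c ^ 2)⁻¹ := by
  rw [norm_mul, norm_pow, norm_inv, Complex.norm_real, Complex.norm_real, mul_pow,
    Real.norm_eq_abs, sq_abs, inv_pow, Real.norm_eq_abs, sq_abs, ← pow_mul]
  have hlam : 0 ≤ lam ^ (2 * 2) := Even.pow_nonneg ⟨2, rfl⟩ _
  gcongr

theorem norm_exchangeKernel_update_sq_le (hmu : mu < m) {c : ℝ} (hc : 0 < c)
    (hcE : c = m * ((n : ℝ) - 1) + mu - E)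
    (hs : ∀ h : ℝ, n * m ≤ h → ‖s h‖ ^ 2 ≤ (h - E + mu)⁻¹) (hm : 0 < m) (i : Fin n)
    {k : Fin n → ℝ × ℝ} (hk : ∀ j, 0 < (k j).1) {x y : ℝ × ℝ} (hx : 0 < x.1) (hy : 0 < y.1) :
    ‖exchangeKernel m lam E t s i (Function.update k i x) y‖ ^ 2 ≤
      ‖t (omega m x + (freeEnergy m k - omega m (k i)))‖ ^ 2 *
        (lam ^ 4 * ((((omega m x + c) + (omega m y + c)) / 2) ^ 2)⁻¹ * (omega m y + c)⁻¹) := by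
  have hr := le_freeEnergy_sub m hk i
  have hmx := le_omega (m := m) hx
  have hmy := le_omega (m := m) hy
  have hden : ((omega m x + c) + (omega m y + c)) / 2 ≤
      omega m x + omega m y + (freeEnergy m k - omega m (k i)) - E := by linarith
  have hsy : ‖s (omega m y + (freeEnergy m k - omega m (k i)))‖ ^ 2 ≤ (omega m y + c)⁻¹ :=
    (hs _ (by linarith)).trans (inv_anti₀ (by linarith) (by linarith))
  rw [exchangeKernel_update, norm_mul, norm_mul, mul_pow, mul_pow, mul_assoc]
  gcongr
  exact norm_exchangeFactor_sq_le lam (by linarith) hden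

theorem IsHSKernel.of_norm_sq_le {i : Fin n} {N : (Fin n → ℝ × ℝ) → ℝ × ℝ → ℂ} {C : NNReal}
    (hN : Measurable (Function.uncurry N)) {g : ℝ × ℝ → ℝ × ℝ → ℝ}
    (hle : ∀ k : Fin n → ℝ × ℝ, (∀ j, 0 < (k j).1) → ∀ x y : ℝ × ℝ, 0 < x.1 → 0 < y.1 →
      ‖N (Function.update k i x) y‖ ^ 2 ≤ g x y)
    (hg : ∫⁻ x, ∫⁻ y, ENNReal.ofReal (g x y) ∂momentumMeasure ∂momentumMeasure ≤ C ^ 2) :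
    IsHSKernel i N C := by
  refine ⟨hN, fun k hk => le_trans ?_ hg⟩
  refine lintegral_mono_ae ?_
  filter_upwards [ae_momentum_pos] with x hx
  refine lintegral_mono_ae ?_
  filter_upwards [ae_momentum_pos] with y hy
  rw [← ofReal_norm, ← ENNReal.ofReal_pow (norm_nonneg _)]
  exact ENNReal.ofReal_le_ofReal (hle k hk x y hx hy)

theorem exists_isHSKernel_exchangeKernel_one (hm : 0 < m) (hmu : mu < m)
    (hE : E < m * ((n : ℝ) - 1) + mu) (hsm : Measurable s)
    (hs : ∀ h : ℝ, n * m ≤ h → ‖s h‖ ^ 2 ≤ (h - E + mu)⁻¹) :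
    ∃ C : NNReal, ∀ i : Fin n, IsHSKernel i (exchangeKernel m lam E (fun _ => 1) s i) C := by
  obtain ⟨c, hcE⟩ : ∃ c, c = m * ((n : ℝ) - 1) + mu - E := ⟨_, rfl⟩
  have hc : 0 < c := by linarith
  have hlam : 0 ≤ 4 * lam ^ 4 := by positivity
  refine ⟨NNReal.sqrt (Real.toNNReal
    (4 * lam ^ 4 * (1 / (4 * Real.pi) * (1 / (4 * Real.pi * c))))), fun i =>
    .of_norm_sq_le (g := fun x y => 4 * lam ^ 4 *
      (((omega m x + (omega m y + 2 * c)) ^ 2)⁻¹ * (omega m y + c)⁻¹))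
      (measurable_exchangeKernel m lam E measurable_const hsm i)
      (fun k hk x y hx hy => ?_) ?_⟩
  · refine (norm_exchangeKernel_update_sq_le hmu hc hcE hs hm i hk hx hy).trans_eq ?_
    rw [norm_one, div_pow, inv_div]
    ring
  · simp only [ENNReal.ofReal_mul hlam, lintegral_const_mul' _ _ ENNReal.ofReal_ne_top]
    rw [← ENNReal.coe_pow, NNReal.sq_sqrt]
    refine (mul_le_mul_right (lintegral_lintegral_inv_sq_mul_inv_le hm hc) _).trans_eq ?_
    rw [← ENNReal.ofReal_mul hlam]
    rfl

theorem isHSKernel_exchangeKernel (hm : 0 < m) (hmu : mu < m) {c : ℝ} (hc : 0 < c)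
    (hcE : c = m * ((n : ℝ) - 1) + mu - E) (hsm : Measurable s)
    (hs : ∀ h : ℝ, n * m ≤ h → ‖s h‖ ^ 2 ≤ (h - E + mu)⁻¹) (i : Fin n) :
    IsHSKernel i (exchangeKernel m lam E s s i)
      (Real.toNNReal (lam ^ 2 * (1 / (4 * Real.pi * c)))) := by
  have hlam : 0 ≤ lam ^ 4 := Even.pow_nonneg ⟨2, rfl⟩ _
  refine .of_norm_sq_le
    (g := fun x y => lam ^ 4 * (((omega m x + c) ^ 2)⁻¹ * ((omega m y + c) ^ 2)⁻¹))
    (measurable_exchangeKernel m lam E hsm hsm i) (fun k hk x y hx hy => ?_) ?_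
  · have hr := le_freeEnergy_sub m hk i
    have hmx := le_omega (m := m) hx
    have hmy := le_omega (m := m) hy
    have hX : 0 < omega m x + c := by linarith
    have hY : 0 < omega m y + c := by linarith
    have hsx : ‖s (omega m x + (freeEnergy m k - omega m (k i)))‖ ^ 2 ≤ (omega m x + c)⁻¹ :=
      (hs _ (by linarith)).trans (inv_anti₀ hX (by linarith))
    have amgm : (omega m x + c) * (omega m y + c) ≤
        (((omega m x + c) + (omega m y + c)) / 2) ^ 2 := by
      linarith [sq_nonneg ((omega m x + c) - (omega m y + c))]
    calc _ ≤ (omega m x + c)⁻¹ *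
          (lam ^ 4 * ((omega m x + c) * (omega m y + c))⁻¹ * (omega m y + c)⁻¹) := by
          refine (norm_exchangeKernel_update_sq_le hmu hc hcE hs hm i hk hx hy).trans ?_
          gcongr
      _ = _ := by field_simp
  · simp only [ENNReal.ofReal_mul hlam, lintegral_const_mul' _ _ ENNReal.ofReal_ne_top]
    refine (mul_le_mul_right (lintegral_lintegral_inv_sq_mul_inv_sq_le m hc) _).trans_eq ?_
    change _ = ENNReal.ofReal _ ^ 2
    rw [← ENNReal.ofReal_mul hlam, ← ENNReal.ofReal_pow (by positivity)]
    congr 1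
    ring

end ExchangeKernel

/-! ### Inverting the principal operator at low real energies -/

theorem neg_lt_re_freeEnergy_sub {m : ℝ} {n : ℕ} {E : ℂ} (hE : E.re < n * m + m) {h : ℝ}
    (hh : n * m ≤ h) : -m < ((h : ℂ) - E).re := by
  simp only [Complex.sub_re, Complex.ofReal_re]
  linarith

theorem ae_integrable_potentialIntegrand {m : ℝ} (hm : 0 < m) {n : ℕ} {E : ℂ}
    (hE : E.re < n * m + m) (ψ : Fock n) :
    ∀ᵐ k ∂nMeasure n, ∀ i, Integrable (potentialIntegrand m E ψ k i) momentumMeasure := by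
  refine ae_all_iff.2 fun i => ?_
  filter_upwards [ae_memLp_update i ψ, ae_le_freeEnergy m n] with k hψ hk
  exact hψ.integrable_mul (memLp_inv_add_omega hm (neg_lt_re_freeEnergy_sub hE hk))

section PrincipalInverse

variable {m mu lam E : ℝ} {n : ℕ} {s : ℝ → ℂ}

theorem mem_graph_potentialOp_iff (hm : 0 < m) {E : ℂ} (hE : E.re < n * m + m) (lam : ℝ)
    (ψ χ : Fock n) :
    (ψ, χ) ∈ (potentialOp m lam n E).graph ↔ amp χ =ᵐ[nMeasure n] fun k =>
      (lam : ℂ) ^ 2 * ∑ i, ∫ p, potentialIntegrand m E ψ k i p ∂momentumMeasure := by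
  rw [mem_graph_potentialOp, and_iff_right (ae_integrable_potentialIntegrand hm hE ψ)]

theorem potential_ae_eq_exchange (lam : ℝ) {E : ℂ} {ψ χ : Fock n}
    (h : amp χ =ᵐ[nMeasure n] fun k => s (freeEnergy m k) * amp ψ k) :
    (fun k => (lam : ℂ) ^ 2 * ∑ i, ∫ p, potentialIntegrand m E χ k i p ∂momentumMeasure)
      =ᵐ[nMeasure n] exchange (exchangeKernel m lam E (fun _ => 1) s) (amp ψ) := by
  filter_upwards [ae_all_iff.2 fun i => ae_update i h] with k hk
  simp only [exchange, Finset.mul_sum, ← integral_const_mul]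
  refine Finset.sum_congr rfl fun i _ => integral_congr_ae ?_
  filter_upwards [hk i] with p hp
  rw [potentialIntegrand, exchangeKernel, hp]
  ring

theorem mul_exchange_exchangeKernel (E : ℂ) (t s : ℝ → ℂ) (f : (Fin n → ℝ × ℝ) → ℂ)
    (k : Fin n → ℝ × ℝ) :
    t (freeEnergy m k) * exchange (exchangeKernel m lam E (fun _ => 1) s) f k =
      exchange (exchangeKernel m lam E t s) f k := by
  simp only [exchange, exchangeKernel, Finset.mul_sum, ← integral_const_mul, one_mul, mul_assoc]

theorem exists_potential_comp (hm : 0 < m) (hmu : mu < m) (hE : E < m * ((n : ℝ) - 1) + mu)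
    (lam : ℝ) (hsm : Measurable s) (hs : ∀ h : ℝ, n * m ≤ h → ‖s h‖ ^ 2 ≤ (h - E + mu)⁻¹)
    {S : Fock n →L[ℂ] Fock n}
    (hS : ∀ ψ, amp (S ψ) =ᵐ[nMeasure n] fun k => s (freeEnergy m k) * amp ψ k) :
    ∃ W : Fock n →L[ℂ] Fock n, ∀ x y, (S x, y) ∈ (potentialOp m lam n E).graph ↔ W x = y := by
  obtain ⟨C, hC⟩ := exists_isHSKernel_exchangeKernel_one (lam := lam) hm hmu hE hsm hs
  obtain ⟨W, -, hW⟩ := exists_clm_exchange hC (exchangeKernel_comp_perm (E : ℂ))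
  refine ⟨W, fun x y => ?_⟩
  have hpot := potential_ae_eq_exchange (E := E) lam (hS x)
  rw [mem_graph_potentialOp_iff hm (by rw [Complex.ofReal_re]; linarith), ← amp_ae_eq_iff hW]
  exact ⟨fun h => h.trans hpot, fun h => h.trans hpot.symm⟩

theorem norm_mul_le_and_isSelfAdjoint_mul (hm : 0 < m) (hmu : mu < m) {c : ℝ} (hc : 0 < c)
    (hcE : c = m * ((n : ℝ) - 1) + mu - E) (hsm : Measurable s)
    (hs : ∀ h : ℝ, n * m ≤ h → ‖s h‖ ^ 2 ≤ (h - E + mu)⁻¹)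
    (hconj : ∀ h : ℝ, n * m ≤ h → (starRingEnd ℂ) (s h) = s h) {S W : Fock n →L[ℂ] Fock n}
    (hS : ∀ ψ, amp (S ψ) =ᵐ[nMeasure n] fun k => s (freeEnergy m k) * amp ψ k)
    (hW : ∀ x y, (S x, y) ∈ (potentialOp m lam n E).graph ↔ W x = y) :
    ‖S * W‖ ≤ n * (lam ^ 2 * (1 / (4 * Real.pi * c))) ∧ IsSelfAdjoint (S * W) := by
  have hHS := isHSKernel_exchangeKernel (lam := lam) hm hmu hc hcE hsm hs
  obtain ⟨T, hnorm, hT⟩ := exists_clm_exchange hHS (exchangeKernel_comp_perm (E : ℂ))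
  have hTSW : T = S * W := by
    ext1 ψ
    refine amp_ext ?_
    have hWψ := ((mem_graph_potentialOp m lam n E (S ψ) (W ψ)).1 ((hW ψ _).2 rfl)).2
    filter_upwards [hT ψ, hS (W ψ), hWψ, potential_ae_eq_exchange (E := E) lam (hS ψ)]
      with k h₁ h₂ h₃ h₄
    rw [h₁, ← mul_exchange_exchangeKernel, ← h₄, ← h₃]
    exact h₂.symm
  rw [Real.coe_toNNReal _ (by positivity)] at hnorm
  exact hTSW ▸ ⟨hnorm, isSelfAdjoint_of_amp_eq_exchange hHS
    (conj_exchangeKernel_update hconj) hT⟩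

theorem exists_relativePotential_and_inverse (hm : 0 < m) (hmu : mu < m)
    (hE : E < m * ((n : ℝ) - 1) + mu - lam ^ 2 * n / (4 * Real.pi)) :
    (∃ T : Fock n →L[ℂ] Fock n,
      relativePotential m mu lam n E = (T : Fock n →ₗ[ℂ] Fock n).toPMap ⊤ ∧ ‖T‖ < 1) ∧
    ∃ Φinv : Fock n →L[ℂ] Fock n,
      HasBoundedInverse (principalOp m mu lam n E) Φinv ∧ IsSelfAdjoint Φinv := by
  obtain ⟨c, hcE⟩ : ∃ c, c = m * ((n : ℝ) - 1) + mu - E := ⟨_, rfl⟩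
  have hlt : lam ^ 2 * n / (4 * Real.pi) < c := by linarith
  have hc : 0 < c := lt_of_le_of_lt (by positivity) hlt
  have hpos (h : ℝ) (hh : n * m ≤ h) : m ≤ h - E + mu := by linarith
  have hsm := measurable_invSqrtSymbol m mu lam E
  have hs (h : ℝ) (hh : n * m ≤ h) : ‖invSqrtSymbol m mu lam E h‖ ^ 2 ≤ (h - E + mu)⁻¹ :=
    norm_invSqrtSymbol_sq_le lam hmu (hm.trans_le (hpos h hh))
  have hconj (h : ℝ) (hh : n * m ≤ h) :=
    conj_invSqrtSymbol (E := E) lam hmu (hm.trans_le (hpos h hh))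
  obtain ⟨S, hS⟩ := exists_clm_funH0 (n := n) (m := m) (C := ⟨√m⁻¹, Real.sqrt_nonneg _⟩) hsm
    fun h hh => Real.le_sqrt_of_sq_le ((hs h hh).trans (inv_anti₀ hm (hpos h hh)))
  have hSgraph (x y : Fock n) : (x, y) ∈ (kineticInvSqrt m mu lam n E).graph ↔ S x = y :=
    (mem_graph_funH0 m n _ x y).trans (amp_ae_eq_iff hS x y)
  have hSK := mem_graph_kineticOp_iff hm hmu (by linarith) hS
  obtain ⟨W, hW⟩ := exists_potential_comp hm hmu (by linarith) lam hsm hs hS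
  obtain ⟨hnorm, hself⟩ := norm_mul_le_and_isSelfAdjoint_mul hm hmu hc hcE hsm hs hconj hS hW
  have hSW : ‖S * W‖ < 1 := by
    refine hnorm.trans_lt ?_
    rw [div_lt_iff₀ (by positivity)] at hlt
    rw [mul_one_div, mul_div_assoc', div_lt_one (by positivity)]
    linarith
  have hSself := isSelfAdjoint_of_amp_eq_mul hS hconj
  have hinv : IsSelfAdjoint (Ring.inverse (1 - S * W)) :=
    IsSelfAdjoint.ringInverse (A := Fock n →L[ℂ] Fock n) ((IsSelfAdjoint.one _).sub hself)
  exact ⟨⟨S * W, pcomp_pcomp_eq_toPMap hSgraph hW, hSW⟩, _, .sub_of_norm_lt_one hSK hW hSW,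
    IsSelfAdjoint.conjugate_self (R := Fock n →L[ℂ] Fock n) hinv hSself⟩

end PrincipalInverse

/-! ### Creation and annihilation against the free resolvent -/

theorem exists_comp_perm_removeNth {n : ℕ} (σ : Equiv.Perm (Fin (n + 1))) (i : Fin (n + 1)) :
    ∃ τ : Equiv.Perm (Fin n), ∀ k : Fin (n + 1) → ℝ × ℝ,
      i.removeNth (k ∘ σ) = (σ i).removeNth k ∘ τ := by
  let e : {x // x ≠ i} ≃ {x // x ≠ σ i} := σ.subtypeEquiv fun a => by simp
  refine ⟨((finSuccAboveEquiv i).trans e).trans (finSuccAboveEquiv (σ i)).symm, fun k => ?_⟩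
  ext1 j
  have h := congrArg Subtype.val
    ((finSuccAboveEquiv (σ i)).apply_symm_apply (e (finSuccAboveEquiv i j)))
  simp only [Fin.removeNth, Function.comp_apply, Equiv.trans_apply]
  exact (congrArg k h).symm

theorem exists_cons_comp_perm {n : ℕ} (σ : Equiv.Perm (Fin n)) :
    ∃ τ : Equiv.Perm (Fin (n + 1)), ∀ (p : ℝ × ℝ) (k : Fin n → ℝ × ℝ),
      (Fin.cons p (k ∘ σ) : Fin (n + 1) → ℝ × ℝ) = (Fin.cons p k : Fin (n + 1) → ℝ × ℝ) ∘ τ := by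
  refine ⟨Equiv.Perm.decomposeFin.symm (0, σ), fun p k => ?_⟩
  ext1 j
  refine Fin.cases ?_ (fun j => ?_) j
  · simp
  · simp

section

variable {m : ℝ} {n : ℕ} {E : ℂ}

theorem ae_amp_insertNth_eq_cons (f : Fock (n + 1)) (i : Fin (n + 1)) :
    ∀ᵐ r ∂nMeasure n, ∀ᵐ p ∂momentumMeasure,
      amp f (i.insertNth p r) = amp f (Fin.cons p r) := by
  filter_upwards [ae_insertNth i (ae_amp_comp_perm f i.cycleRange.symm)] with r hr
  filter_upwards [hr] with p hp
  rw [← hp, Fin.insertNth_comp_cycleRange_symm]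

theorem ae_amp_removeNth_comp_perm (g : Fock n) (σ : Equiv.Perm (Fin (n + 1))) :
    ∀ᵐ k ∂nMeasure (n + 1), ∀ i : Fin (n + 1),
      amp g (i.removeNth (k ∘ σ)) = amp g ((σ i).removeNth k) := by
  refine ae_all_iff.2 fun i => ?_
  obtain ⟨τ, hτ⟩ := exists_comp_perm_removeNth σ i
  filter_upwards [ae_removeNth (σ i) (ae_amp_comp_perm g τ)] with k hk
  rw [hτ, hk]

theorem freeEnergy_cons_sub (m : ℝ) (E : ℂ) (p : ℝ × ℝ) (k : Fin n → ℝ × ℝ) :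
    (freeEnergy m (Fin.cons p k : Fin (n + 1) → ℝ × ℝ) : ℂ) - E =
      (freeEnergy m k : ℂ) - E + omega m p := by
  rw [freeEnergy_cons, Complex.ofReal_add]
  ring

theorem exists_lintegral_resolvent_le (hm : 0 < m) (hE : E.re < n * m + m) :
    ∃ C : NNReal, ∀ h : ℝ, n * m ≤ h →
      ∫⁻ p, ‖((h : ℂ) - E + omega m p)⁻¹‖ₑ ^ 2 ∂momentumMeasure ≤ C := by
  obtain ⟨C, hC⟩ := exists_lintegral_inv_sq_le hm (d := n * m + m - E.re) (by linarith)
  refine ⟨C, fun h hh => hC _ ?_⟩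
  simp only [Complex.sub_re, Complex.ofReal_re]
  linarith

/-- The function `φ⁽⁺⁾ (H₀ - E)⁻¹ f`, without the factor `√(n+1)`. -/
def annihilate (m : ℝ) (E : ℂ) (f : Fock (n + 1)) (k : Fin n → ℝ × ℝ) : ℂ :=
  ∫ p : ℝ × ℝ, amp f (Fin.cons p k) /
    ((freeEnergy m (Fin.cons p k : Fin (n + 1) → ℝ × ℝ) : ℂ) - E) ∂momentumMeasure

theorem ae_integrable_annihilate (hm : 0 < m) (hE : E.re < n * m + m) (f : Fock (n + 1)) :
    ∀ᵐ k ∂nMeasure n, Integrable (fun p : ℝ × ℝ => amp f (Fin.cons p k) /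
      ((freeEnergy m (Fin.cons p k : Fin (n + 1) → ℝ × ℝ) : ℂ) - E)) momentumMeasure := by
  filter_upwards [ae_memLp_cons f, ae_le_freeEnergy m n] with k hf hk
  simp only [freeEnergy_cons_sub, div_eq_mul_inv]
  exact hf.integrable_mul (memLp_inv_add_omega hm (neg_lt_re_freeEnergy_sub hE hk))

theorem annihilate_add (hm : 0 < m) (hE : E.re < n * m + m) (f g : Fock (n + 1)) :
    annihilate m E (f + g) =ᵐ[nMeasure n] annihilate m E f + annihilate m E g := by
  filter_upwards [ae_cons (amp_add f g), ae_integrable_annihilate hm hE f,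
    ae_integrable_annihilate hm hE g] with k hfg hf hg
  rw [Pi.add_apply, annihilate, annihilate, annihilate, ← integral_add hf hg]
  refine integral_congr_ae ?_
  filter_upwards [hfg] with p hp
  rw [hp, Pi.add_apply, add_div]

theorem annihilate_smul (m : ℝ) (E c : ℂ) (f : Fock (n + 1)) :
    annihilate m E (c • f) =ᵐ[nMeasure n] c • annihilate m E f := by
  filter_upwards [ae_cons (amp_smul c f)] with k hf
  rw [Pi.smul_apply, annihilate, annihilate, smul_eq_mul, ← integral_const_mul]
  refine integral_congr_ae ?_
  filter_upwards [hf] with p hp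
  rw [hp, Pi.smul_apply, smul_eq_mul, mul_div_assoc]

theorem annihilate_comp_perm (m : ℝ) (E : ℂ) (f : Fock (n + 1)) (σ : Equiv.Perm (Fin n)) :
    ∀ᵐ k ∂nMeasure n, annihilate m E f (k ∘ σ) = annihilate m E f k := by
  obtain ⟨τ, hτ⟩ := exists_cons_comp_perm σ
  filter_upwards [ae_cons (ae_amp_comp_perm f τ)] with k hk
  refine integral_congr_ae ?_
  filter_upwards [hk] with p hp
  rw [hτ, freeEnergy_comp_perm, hp]

theorem measurable_cons : Measurable fun q : (Fin n → ℝ × ℝ) × (ℝ × ℝ) =>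
    (Fin.cons q.2 q.1 : Fin (n + 1) → ℝ × ℝ) := by
  simpa only [Function.comp_def, Fin.insertNth_zero', Prod.fst_swap, Prod.snd_swap] using
    (measurable_insertNth (n := n) 0).comp measurable_swap

theorem stronglyMeasurable_annihilate (m : ℝ) (E : ℂ) (f : Fock (n + 1)) :
    StronglyMeasurable (annihilate m E f) := by
  have hcons := measurable_cons (n := n)
  have hf : Measurable fun q : (Fin n → ℝ × ℝ) × (ℝ × ℝ) => amp f (Fin.cons q.2 q.1) :=
    (measurable_amp f).comp hcons
  have hfe : Measurable fun q : (Fin n → ℝ × ℝ) × (ℝ × ℝ) =>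
      freeEnergy m (Fin.cons q.2 q.1 : Fin (n + 1) → ℝ × ℝ) :=
    (measurable_freeEnergy m (n + 1)).comp hcons
  exact StronglyMeasurable.integral_prod_right (f := fun (k : Fin n → ℝ × ℝ) p =>
    amp f (Fin.cons p k) / ((freeEnergy m (Fin.cons p k : Fin (n + 1) → ℝ × ℝ) : ℂ) - E))
    (Measurable.stronglyMeasurable (by unfold Function.uncurry; fun_prop))

theorem lintegral_annihilate_sq_le (hm : 0 < m) (hE : E.re < n * m + m) {C : NNReal}
    (hC : ∀ h : ℝ, n * m ≤ h →
      ∫⁻ p, ‖((h : ℂ) - E + omega m p)⁻¹‖ₑ ^ 2 ∂momentumMeasure ≤ C) (f : Fock (n + 1)) :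
    ∫⁻ k, ‖annihilate m E f k‖ₑ ^ 2 ∂nMeasure n ≤
      C * ∫⁻ k, ‖amp f k‖ₑ ^ 2 ∂nMeasure (n + 1) := by
  have hf := measurable_amp f
  have hf2 : Measurable fun k => ‖amp f k‖ₑ ^ 2 := by fun_prop
  rw [lintegral_insertNth 0 hf2]
  simp only [Fin.insertNth_zero']
  have hslice : Measurable fun r : Fin n → ℝ × ℝ =>
      ∫⁻ p, ‖amp f (Fin.cons p r)‖ₑ ^ 2 ∂momentumMeasure :=
    (hf2.comp measurable_cons).lintegral_prod_right'
  rw [← lintegral_const_mul _ hslice]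
  refine lintegral_mono_ae ?_
  filter_upwards [ae_memLp_cons f, ae_le_freeEnergy m n] with k hfk hk
  simp only [annihilate, freeEnergy_cons_sub, div_eq_mul_inv]
  rw [mul_comm (C : ENNReal)]
  refine (enorm_integral_mul_sq_le hfk.1
    (memLp_inv_add_omega hm (neg_lt_re_freeEnergy_sub hE hk)).1).trans ?_
  gcongr
  exact hC _ hk

theorem exists_clm_annihilate (hm : 0 < m) (hE : E.re < n * m + m) :
    ∃ T : Fock (n + 1) →L[ℂ] Fock n, ∀ f, amp (T f) =ᵐ[nMeasure n] annihilate m E f := by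
  obtain ⟨C, hC⟩ := exists_lintegral_resolvent_le (n := n) hm hE
  obtain ⟨T, -, hT⟩ := exists_clm_amp_ae_eq (C := NNReal.sqrt C) (annihilate_add hm hE)
    (annihilate_smul m E) (fun f => (stronglyMeasurable_annihilate m E f).aestronglyMeasurable)
    (annihilate_comp_perm m E) fun f => by
      rw [← ENNReal.coe_pow, NNReal.sq_sqrt]
      exact lintegral_annihilate_sq_le hm hE hC f
  exact ⟨T, hT⟩

theorem measurable_resolvent_mul_removeNth (m : ℝ) (E : ℂ) (g : Fock n) (i : Fin (n + 1)) :
    Measurable fun k : Fin (n + 1) → ℝ × ℝ =>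
      ((freeEnergy m k : ℂ) - E)⁻¹ * amp g (i.removeNth k) := by
  have hfe := measurable_freeEnergy m (n + 1)
  have hg : Measurable fun k : Fin (n + 1) → ℝ × ℝ => amp g (i.removeNth k) :=
    (measurable_amp g).comp (measurable_pi_lambda _ fun j => measurable_pi_apply _)
  fun_prop

theorem lintegral_resolvent_mul_removeNth_sq_le {C : NNReal} (hC : ∀ h : ℝ, n * m ≤ h →
      ∫⁻ p, ‖((h : ℂ) - E + omega m p)⁻¹‖ₑ ^ 2 ∂momentumMeasure ≤ C) (g : Fock n)
    (i : Fin (n + 1)) :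
    ∫⁻ k, ‖((freeEnergy m k : ℂ) - E)⁻¹ * amp g (i.removeNth k)‖ₑ ^ 2 ∂nMeasure (n + 1) ≤
      C * ∫⁻ k, ‖amp g k‖ₑ ^ 2 ∂nMeasure n := by
  have hg := measurable_amp g
  have hω := measurable_omega m
  rw [lintegral_insertNth i ((measurable_resolvent_mul_removeNth m E g i).enorm.pow_const 2),
    ← lintegral_const_mul _ (by fun_prop)]
  refine lintegral_mono_ae ?_
  filter_upwards [ae_le_freeEnergy m n] with r hr
  simp only [enorm_mul, mul_pow, Fin.removeNth_insertNth, freeEnergy_insertNth]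
  rw [lintegral_mul_const _ (by fun_prop)]
  gcongr
  refine le_trans (le_of_eq (lintegral_congr fun p => ?_)) (hC _ hr)
  rw [Complex.ofReal_add, add_comm, add_sub_right_comm]

theorem memLp_resolvent_mul_removeNth (hm : 0 < m) (hE : E.re < n * m + m) (g : Fock n)
    (i : Fin (n + 1)) :
    MemLp (fun k => ((freeEnergy m k : ℂ) - E)⁻¹ * amp g (i.removeNth k)) 2
      (nMeasure (n + 1)) := by
  obtain ⟨C, hC⟩ := exists_lintegral_resolvent_le hm hE
  refine (memLp_two_iff_lintegral_enorm_sq_lt_top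
    (measurable_resolvent_mul_removeNth m E g i).aestronglyMeasurable).2 <|
    (lintegral_resolvent_mul_removeNth_sq_le hC g i).trans_lt <|
      ENNReal.mul_lt_top ENNReal.coe_lt_top ?_
  exact (memLp_two_iff_lintegral_enorm_sq_lt_top (memLp_amp g).1).1 (memLp_amp g)

theorem exists_isAInvBdag (hm : 0 < m) (lam : ℝ) (hE : E.re < n * m + m) (g : Fock n) :
    ∃ u, IsAInvBdag m lam n E g u := by
  refine exists_amp_ae_eq ?_ fun σ => ?_
  · simp only [mul_left_comm _ ((lam : ℂ) * _), Finset.mul_sum _ _ (_ - E)⁻¹]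
    exact (memLp_finsetSum _ fun i _ => memLp_resolvent_mul_removeNth hm hE g i).const_mul _
  · filter_upwards [ae_amp_removeNth_comp_perm g σ] with k hk
    rw [freeEnergy_comp_perm, Finset.sum_congr rfl fun i _ => hk i,
      Equiv.sum_comp σ fun i => amp g (i.removeNth k)]

theorem integral_resolvent_mul_removeNth_mul_conj (hm : 0 < m) (hE : E.re < n * m + m)
    (g : Fock n) (f : Fock (n + 1)) (i : Fin (n + 1)) :
    ∫ k, ((freeEnergy m k : ℂ) - E)⁻¹ * amp g (i.removeNth k) * (starRingEnd ℂ) (amp f k)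
        ∂nMeasure (n + 1) =
      ∫ r, amp g r * (starRingEnd ℂ) (annihilate m ((starRingEnd ℂ) E) f r) ∂nMeasure n := by
  rw [integral_insertNth i
    (integrable_mul_conj (memLp_resolvent_mul_removeNth hm hE g i) (memLp_amp f))]
  refine integral_congr_ae ?_
  filter_upwards [ae_amp_insertNth_eq_cons f i] with r hr
  rw [annihilate, ← integral_conj, ← integral_const_mul]
  refine integral_congr_ae ?_
  filter_upwards [hr] with p hp
  rw [hp, Fin.removeNth_insertNth, freeEnergy_insertNth, freeEnergy_cons, map_div₀, map_sub,
    Complex.conj_ofReal, Complex.conj_conj]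
  ring

theorem ofReal_sqrt_mul_inv_sqrt (n : ℕ) :
    ((√(n + 1) : ℝ) : ℂ) * (((√(n + 1))⁻¹ : ℝ) : ℂ) = 1 := by
  rw [← Complex.ofReal_mul, mul_inv_cancel₀ (Real.sqrt_pos.2 (by positivity)).ne',
    Complex.ofReal_one]

theorem inner_isBAInv_eq_inner_isAInvBdag (hm : 0 < m) {lam : ℝ} (hE : E.re < n * m + m)
    {f : Fock (n + 1)} {w : Fock n} (hw : IsBAInv m lam n ((starRingEnd ℂ) E) f w)
    {g : Fock n} {u : Fock (n + 1)} (hu : IsAInvBdag m lam n E g u) :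
    inner ℂ w g = inner ℂ f u := by
  have hint (i : Fin (n + 1)) := integrable_mul_conj (memLp_resolvent_mul_removeNth hm hE g i)
    (memLp_amp f)
  have hu' : ∫ k, amp u k * (starRingEnd ℂ) (amp f k) ∂nMeasure (n + 1) =
      (lam : ℂ) * (((√(n + 1))⁻¹ : ℝ) : ℂ) * ∑ i : Fin (n + 1),
        ∫ k, ((freeEnergy m k : ℂ) - E)⁻¹ * amp g (i.removeNth k) *
          (starRingEnd ℂ) (amp f k) ∂nMeasure (n + 1) := by
    rw [← integral_finsetSum _ fun i _ => hint i, ← integral_const_mul]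
    refine integral_congr_ae ?_
    filter_upwards [hu] with k hk
    rw [hk, ← Finset.sum_mul, ← Finset.mul_sum]
    ring
  have hn : (((√(n + 1))⁻¹ : ℝ) : ℂ) * (n + 1 : ℕ) = (√(n + 1) : ℝ) := by
    rw [← Complex.ofReal_natCast, ← Complex.ofReal_mul, Nat.cast_add_one, inv_mul_eq_div,
      Real.div_sqrt]
  rw [inner_eq_integral, inner_eq_integral, hu',
    Finset.sum_congr rfl fun i _ => integral_resolvent_mul_removeNth_mul_conj hm hE g f i,
    Finset.sum_const, Finset.card_univ, Fintype.card_fin, nsmul_eq_mul, ← mul_assoc,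
    mul_assoc (lam : ℂ), hn, ← integral_const_mul]
  refine integral_congr_ae ?_
  filter_upwards [hw.2] with r hr
  rw [hr, map_mul, map_mul, Complex.conj_ofReal, Complex.conj_ofReal, annihilate]
  ring

/-- `A`, `B` and `C` are the bounded operators `a⁻¹`, `b a⁻¹` and `a⁻¹ b†` at the energy `E`, out of
which the blocks of `(H - E)⁻¹` are built. -/
structure IsFreeBlocks (m lam : ℝ) (n : ℕ) (E : ℂ) (A : Fock (n + 1) →L[ℂ] Fock (n + 1))
    (B : Fock (n + 1) →L[ℂ] Fock n) (C : Fock n →L[ℂ] Fock (n + 1)) : Prop where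
  amp_aInv : ∀ f, amp (A f) =ᵐ[nMeasure (n + 1)] fun k => ((freeEnergy m k : ℂ) - E)⁻¹ * amp f k
  isBAInv : ∀ f, IsBAInv m lam n E f (B f)
  isAInvBdag : ∀ g, IsAInvBdag m lam n E g (C g)

theorem exists_clm_isBAInv (hm : 0 < m) (lam : ℝ) (hE : E.re < n * m + m) :
    ∃ B : Fock (n + 1) →L[ℂ] Fock n, ∀ f, IsBAInv m lam n E f (B f) := by
  obtain ⟨T, hT⟩ := exists_clm_annihilate hm hE
  refine ⟨((lam : ℂ) * (√(n + 1) : ℝ)) • T, fun f => ⟨ae_integrable_annihilate hm hE f, ?_⟩⟩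
  filter_upwards [hT f, amp_smul ((lam : ℂ) * (√(n + 1) : ℝ)) (T f)] with k hk hsmul
  rw [smul_apply, hsmul, Pi.smul_apply, hk, smul_eq_mul, annihilate]

theorem isAInvBdag_adjoint (hm : 0 < m) {lam : ℝ} (hE : E.re < n * m + m)
    {B : Fock (n + 1) →L[ℂ] Fock n} (hB : ∀ f, IsBAInv m lam n ((starRingEnd ℂ) E) f (B f))
    (g : Fock n) : IsAInvBdag m lam n E g (B.adjoint g) := by
  obtain ⟨u, hu⟩ := exists_isAInvBdag hm lam hE g
  have hBg : B.adjoint g = u := ext_inner_left ℂ fun f => by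
    rw [ContinuousLinearMap.adjoint_inner_right,
      inner_isBAInv_eq_inner_isAInvBdag hm hE (hB f) hu]
  exact hBg ▸ hu

theorem exists_isFreeBlocks (hm : 0 < m) (lam : ℝ) (hE : E.re < n * m + m) :
    ∃ A B C, IsFreeBlocks m lam n E A B C := by
  have hd : 0 < n * m + m - E.re := by linarith
  obtain ⟨A, hA⟩ := exists_clm_funH0 (m := m) (n := n + 1) (s := fun h => ((h : ℂ) - E)⁻¹)
    (C := ⟨(n * m + m - E.re)⁻¹, by positivity⟩) (by fun_prop) fun h hh => by
      rw [norm_inv]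
      refine inv_anti₀ hd (le_trans ?_ (Complex.re_le_norm _))
      push_cast at hh
      simp only [Complex.sub_re, Complex.ofReal_re]
      linarith
  obtain ⟨B, hB⟩ := exists_clm_isBAInv hm lam hE
  obtain ⟨B', hB'⟩ := exists_clm_isBAInv (n := n) (E := (starRingEnd ℂ) E) hm lam hE
  exact ⟨A, B, B'.adjoint, hA, hB, isAInvBdag_adjoint hm hE hB'⟩

end

/-! ### The principal operator at two energies -/

section TwoEnergies

variable {m mu lam : ℝ} {n : ℕ} {E F : ℂ}

theorem add_omega_ne_zero {z : ℂ} (hz : -m < z.re) {p : ℝ × ℝ} (hp : m ≤ omega m p) :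
    z + omega m p ≠ 0 := fun h => by
  have hre := congrArg Complex.re h
  simp only [Complex.add_re, Complex.ofReal_re, Complex.zero_re] at hre
  linarith

theorem integrable_kineticIntegrand (hm : 0 < m) (hmu : mu < m) {z : ℂ} (hz : -m < z.re) :
    Integrable (fun p => 1 / ((omega m p : ℂ) - mu) - 1 / (z + omega m p)) momentumMeasure := by
  have hmu' : -m < (-mu : ℂ).re := by simpa using hmu
  refine ((integrable_inv_mul_inv hm hmu' hz).const_mul (z + mu)).congr ?_
  filter_upwards [ae_le_omega m] with p hp
  have hω : (omega m p : ℂ) - mu ≠ 0 := by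
    simpa only [neg_add_eq_sub] using add_omega_ne_zero hmu' hp
  have hz' := add_omega_ne_zero hz hp
  rw [neg_add_eq_sub]
  field_simp
  ring

/-- The symbol of the diagonal part of `b a(E)⁻¹ a(F)⁻¹ b†`, in which the boson that is created is
the one that is annihilated. -/
def contractionSymbol (m lam : ℝ) (E F : ℂ) (h : ℝ) : ℂ :=
  (lam : ℂ) ^ 2 *
    ∫ p, ((h : ℂ) - E + omega m p)⁻¹ * ((h : ℂ) - F + omega m p)⁻¹ ∂momentumMeasure

theorem measurable_contractionSymbol (m lam : ℝ) (E F : ℂ) :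
    Measurable (contractionSymbol m lam E F) := by
  have hω := measurable_omega m
  have hint : StronglyMeasurable fun h : ℝ => ∫ p, ((h : ℂ) - E + omega m p)⁻¹ *
      ((h : ℂ) - F + omega m p)⁻¹ ∂momentumMeasure :=
    StronglyMeasurable.integral_prod_right (f := fun (h : ℝ) p =>
      ((h : ℂ) - E + omega m p)⁻¹ * ((h : ℂ) - F + omega m p)⁻¹)
      (Measurable.stronglyMeasurable (by unfold Function.uncurry; fun_prop))
  exact hint.measurable.const_mul _

theorem exists_norm_contractionSymbol_le (hm : 0 < m) (lam : ℝ) (hE : E.re < n * m + m)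
    (hF : F.re < n * m + m) :
    ∃ C : NNReal, ∀ h : ℝ, n * m ≤ h → ‖contractionSymbol m lam E F h‖ ≤ C := by
  obtain ⟨C, hC⟩ := exists_lintegral_resolvent_le hm hE
  obtain ⟨D, hD⟩ := exists_lintegral_resolvent_le hm hF
  refine ⟨‖(lam : ℂ) ^ 2‖₊ * NNReal.sqrt (C * D), fun h hh => ?_⟩
  have hle := (enorm_integral_mul_sq_le
    (memLp_inv_add_omega hm (neg_lt_re_freeEnergy_sub hE hh)).1
    (memLp_inv_add_omega hm (neg_lt_re_freeEnergy_sub hF hh)).1).trans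
    (mul_le_mul' (hC h hh) (hD h hh))
  rw [enorm_eq_nnnorm, ← ENNReal.coe_pow, ← ENNReal.coe_mul, ENNReal.coe_le_coe] at hle
  rw [contractionSymbol, norm_mul, NNReal.coe_mul]
  exact mul_le_mul_of_nonneg_left (NNReal.coe_le_coe.2 (NNReal.le_sqrt_iff_sq_le.2 hle))
    (norm_nonneg _)

theorem exists_clm_contraction (hm : 0 < m) (lam : ℝ) (hE : E.re < n * m + m)
    (hF : F.re < n * m + m) :
    ∃ M : Fock n →L[ℂ] Fock n, ∀ x, amp (M x) =ᵐ[nMeasure n] fun k =>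
      contractionSymbol m lam E F (freeEnergy m k) * amp x k :=
  let ⟨_, hC⟩ := exists_norm_contractionSymbol_le hm lam hE hF
  exists_clm_funH0 (measurable_contractionSymbol m lam E F) hC

theorem kineticSymbol_sub (hm : 0 < m) (hmu : mu < m) (lam : ℝ) {h : ℝ}
    (hE : -m < ((h : ℂ) - E).re) (hF : -m < ((h : ℂ) - F).re) :
    kineticSymbol m mu lam F h - kineticSymbol m mu lam E h =
      (E - F) * (1 + contractionSymbol m lam E F h) := by
  have hsub := integral_sub (integrable_kineticIntegrand hm hmu hF)
    (integrable_kineticIntegrand hm hmu hE)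
  have hres : ∫ p, ((1 / ((omega m p : ℂ) - mu) - 1 / ((h : ℂ) - F + omega m p)) -
      (1 / ((omega m p : ℂ) - mu) - 1 / ((h : ℂ) - E + omega m p))) ∂momentumMeasure =
      (E - F) * ∫ p, ((h : ℂ) - E + omega m p)⁻¹ * ((h : ℂ) - F + omega m p)⁻¹
        ∂momentumMeasure := by
    rw [← integral_const_mul]
    refine integral_congr_ae ?_
    filter_upwards [ae_le_omega m] with p hp
    have hE' := add_omega_ne_zero hE hp
    have hF' := add_omega_ne_zero hF hp
    rw [sub_sub_sub_cancel_left]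
    field_simp
    ring
  simp only [kineticSymbol, contractionSymbol]
  linear_combination (lam : ℂ) ^ 2 * (hres - hsub)

/-- The integrand of the exchange part of `b a(E)⁻¹ a(F)⁻¹ b†`, in which the momentum `k i` is
replaced by `p`. -/
def exchangeIntegrand (m : ℝ) (E F : ℂ) (x : Fock n) (k : Fin n → ℝ × ℝ) (i : Fin n)
    (p : ℝ × ℝ) : ℂ :=
  ((freeEnergy m k : ℂ) - E + omega m p)⁻¹ * ((freeEnergy m k : ℂ) - F + omega m p)⁻¹ *
    amp x (Function.update k i p)

theorem ae_integrable_exchangeIntegrand (hm : 0 < m) (hE : E.re < n * m + m)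
    (hF : F.re < n * m + m) (x : Fock n) :
    ∀ᵐ k ∂nMeasure n, ∀ i, Integrable (exchangeIntegrand m E F x k i) momentumMeasure := by
  filter_upwards [ae_integrable_potentialIntegrand hm hF x, ae_le_freeEnergy m n] with k hk hle i
  have hbdd := (hk i).bdd_mul (c := (n * m + m - E.re)⁻¹)
    (memLp_inv_add_omega hm (neg_lt_re_freeEnergy_sub hE hle)).1 <| by
      filter_upwards [ae_le_omega m] with p hp
      rw [norm_inv]
      refine inv_anti₀ (by linarith) (le_trans ?_ (Complex.re_le_norm _))
      simp only [Complex.add_re, Complex.sub_re, Complex.ofReal_re]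
      linarith
  refine hbdd.congr (ae_of_all _ fun p => ?_)
  simp only [potentialIntegrand, exchangeIntegrand]
  ring

theorem integral_potentialIntegrand_sub (hm : 0 < m) (hE : E.re < n * m + m)
    (hF : F.re < n * m + m) (x : Fock n) :
    ∀ᵐ k ∂nMeasure n, ∀ i, (∫ p, potentialIntegrand m E x k i p ∂momentumMeasure) -
      ∫ p, potentialIntegrand m F x k i p ∂momentumMeasure =
        (E - F) * ∫ p, exchangeIntegrand m E F x k i p ∂momentumMeasure := by
  filter_upwards [ae_integrable_potentialIntegrand hm hE x,
    ae_integrable_potentialIntegrand hm hF x, ae_le_freeEnergy m n] with k hkE hkF hle i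
  rw [← integral_sub (hkE i) (hkF i), ← integral_const_mul]
  refine integral_congr_ae ?_
  filter_upwards [ae_le_omega m] with p hp
  have hE' := add_omega_ne_zero (neg_lt_re_freeEnergy_sub hE hle) hp
  have hF' := add_omega_ne_zero (neg_lt_re_freeEnergy_sub hF hle) hp
  simp only [potentialIntegrand, exchangeIntegrand]
  field_simp
  ring

theorem ae_amp_removeNth_succ_cons (x : Fock n) :
    ∀ᵐ k ∂nMeasure n, ∀ j : Fin n, ∀ᵐ p ∂momentumMeasure,
      amp x (j.succ.removeNth (Fin.cons p k : Fin (n + 1) → ℝ × ℝ)) =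
        amp x (Function.update k j p) := by
  refine ae_all_iff.2 fun j => ?_
  cases n with
  | zero => exact j.elim0
  | succ n =>
    filter_upwards [ae_update j (ae_amp_comp_perm x j.cycleRange.symm)] with k hk
    filter_upwards [hk] with p hp
    rw [← hp, ← Fin.cons_removeNth_eq_comp_cycleRange_symm, Function.update_self,
      Fin.removeNth_update]
    congr 1
    ext1 i
    refine Fin.cases ?_ (fun i => ?_) i <;> simp [Fin.removeNth]

theorem IsBAInv.amp_eq_of_isAInvBdag (hm : 0 < m) (hE : E.re < n * m + m)
    (hF : F.re < n * m + m) {x w : Fock n} {c : Fock (n + 1)} (hw : IsBAInv m lam n E c w)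
    (hc : IsAInvBdag m lam n F x c) :
    amp w =ᵐ[nMeasure n] fun k => contractionSymbol m lam E F (freeEnergy m k) * amp x k +
      (lam : ℂ) ^ 2 * ∑ j, ∫ p, exchangeIntegrand m E F x k j p ∂momentumMeasure := by
  filter_upwards [hw.2, ae_cons (P := fun k => amp c k = _) hc, ae_amp_removeNth_succ_cons x,
    ae_integrable_exchangeIntegrand hm hE hF x, ae_le_freeEnergy m n] with k hwk hck hxk hint hk
  have hdiag := integrable_inv_mul_inv hm (neg_lt_re_freeEnergy_sub hE hk)
    (neg_lt_re_freeEnergy_sub hF hk)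
  have hsplit : ∫ p : ℝ × ℝ, amp c (Fin.cons p k) /
      ((freeEnergy m (Fin.cons p k : Fin (n + 1) → ℝ × ℝ) : ℂ) - E) ∂momentumMeasure =
      ∫ p, ((lam : ℂ) * (((√(n + 1))⁻¹ : ℝ) : ℂ)) *
        (((freeEnergy m k : ℂ) - E + omega m p)⁻¹ * ((freeEnergy m k : ℂ) - F + omega m p)⁻¹ *
          amp x k + ∑ j, exchangeIntegrand m E F x k j p) ∂momentumMeasure := by
    refine integral_congr_ae ?_
    filter_upwards [hck, ae_all_iff.2 hxk] with p hcp hxp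
    simp only [exchangeIntegrand]
    rw [hcp, freeEnergy_cons_sub, freeEnergy_cons_sub, Fin.sum_univ_succ, Fin.removeNth_zero,
      Fin.tail_cons, Finset.sum_congr rfl fun j _ => hxp j, ← Finset.mul_sum]
    ring
  rw [hwk, hsplit, integral_const_mul,
    integral_add (hdiag.mul_const _) (integrable_finsetSum _ fun j _ => hint j),
    integral_mul_const, integral_finsetSum _ fun j _ => hint j, contractionSymbol]
  linear_combination (lam : ℂ) ^ 2 * (((∫ p, ((freeEnergy m k : ℂ) - E + omega m p)⁻¹ *
    ((freeEnergy m k : ℂ) - F + omega m p)⁻¹ ∂momentumMeasure) * amp x k) +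
    ∑ j, ∫ p, exchangeIntegrand m E F x k j p ∂momentumMeasure) * ofReal_sqrt_mul_inv_sqrt n

theorem amp_sub (x y : Fock n) : amp (x - y) =ᵐ[nMeasure n] amp x - amp y :=
  Lp.coeFn_sub (x : Lp ℂ 2 (nMeasure n)) y

theorem mem_graph_kineticOp_of_mem (hm : 0 < m) (hmu : mu < m) (hE : E.re < n * m + m)
    (hF : F.re < n * m + m) {M : Fock n →L[ℂ] Fock n}
    (hM : ∀ x, amp (M x) =ᵐ[nMeasure n] fun k =>
      contractionSymbol m lam E F (freeEnergy m k) * amp x k) {x u : Fock n}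
    (hu : (x, u) ∈ (kineticOp m mu lam n F).graph) :
    (x, u - (E - F) • (x + M x)) ∈ (kineticOp m mu lam n E).graph := by
  rw [kineticOp, mem_graph_funH0] at hu ⊢
  filter_upwards [hu, hM x, amp_sub u ((E - F) • (x + M x)), amp_smul (E - F) (x + M x),
    amp_add x (M x), ae_le_freeEnergy m n] with k huk hMk hsub hsmul hadd hk
  rw [hsub, Pi.sub_apply, hsmul, Pi.smul_apply, hadd, Pi.add_apply, huk, hMk, smul_eq_mul]
  linear_combination amp x k * kineticSymbol_sub hm hmu lam (neg_lt_re_freeEnergy_sub hE hk)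
    (neg_lt_re_freeEnergy_sub hF hk)

theorem mem_graph_potentialOp_of_mem (hm : 0 < m) (hE : E.re < n * m + m)
    (hF : F.re < n * m + m) {M : Fock n →L[ℂ] Fock n}
    (hM : ∀ x, amp (M x) =ᵐ[nMeasure n] fun k =>
      contractionSymbol m lam E F (freeEnergy m k) * amp x k) {x v w : Fock n} {c : Fock (n + 1)}
    (hc : IsAInvBdag m lam n F x c) (hw : IsBAInv m lam n E c w)
    (hv : (x, v) ∈ (potentialOp m lam n F).graph) :
    (x, v + (E - F) • (w - M x)) ∈ (potentialOp m lam n E).graph := by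
  rw [mem_graph_potentialOp_iff hm hF] at hv
  rw [mem_graph_potentialOp_iff hm hE]
  filter_upwards [hv, hM x, amp_add v ((E - F) • (w - M x)), amp_smul (E - F) (w - M x),
    amp_sub w (M x), hw.amp_eq_of_isAInvBdag hm hE hF hc,
    integral_potentialIntegrand_sub hm hE hF x] with k hvk hMk hadd hsmul hsub hwk hpot
  have hsum := Finset.sum_congr rfl fun i (_ : i ∈ Finset.univ) => hpot i
  rw [Finset.sum_sub_distrib, ← Finset.mul_sum] at hsum
  rw [hadd, Pi.add_apply, hsmul, Pi.smul_apply, hsub, Pi.sub_apply, hvk, hMk, hwk, smul_eq_mul]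
  linear_combination -(lam : ℂ) ^ 2 * hsum

theorem mem_graph_principalOp_of_mem (hm : 0 < m) (hmu : mu < m) (hE : E.re < n * m + m)
    (hF : F.re < n * m + m) {x y w : Fock n} {c : Fock (n + 1)}
    (hc : IsAInvBdag m lam n F x c) (hw : IsBAInv m lam n E c w)
    (hxy : (x, y) ∈ (principalOp m mu lam n F).graph) :
    (x, y - (E - F) • (x + w)) ∈ (principalOp m mu lam n E).graph := by
  obtain ⟨M, hM⟩ := exists_clm_contraction (n := n) hm lam hE hF
  obtain ⟨u, v, hu, hv, rfl⟩ := (mem_graph_sub _ _ _ _).1 hxy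
  exact (mem_graph_sub _ _ _ _).2 ⟨_, _, mem_graph_kineticOp_of_mem hm hmu hE hF hM hu,
    mem_graph_potentialOp_of_mem hm hE hF hM hc hw hv, by module⟩

end TwoEnergies

/-! ### The block resolvent -/

section BlockResolvent

variable {m mu lam : ℝ} {n : ℕ} {E F : ℂ} {A A₀ : Fock (n + 1) →L[ℂ] Fock (n + 1)}
  {B B₀ : Fock (n + 1) →L[ℂ] Fock n} {C C₀ : Fock n →L[ℂ] Fock (n + 1)}
  {Ψ Ψ₀ : Fock n →L[ℂ] Fock n}

theorem ae_freeEnergy_sub_ne_zero (hE : E.re < n * m + m) :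
    ∀ᵐ k ∂nMeasure (n + 1), (freeEnergy m k : ℂ) - E ≠ 0 := by
  filter_upwards [ae_le_freeEnergy m (n + 1)] with k hk h
  have hre := congrArg Complex.re h
  push_cast at hk
  simp only [Complex.sub_re, Complex.ofReal_re, Complex.zero_re] at hre
  linarith

theorem IsFreeBlocks.isBlockResolvent_iff (h : IsFreeBlocks m lam n E A B C)
    (R : Sector n →L[ℂ] Sector n) :
    IsBlockResolvent m lam n E Ψ R ↔ R = blockOperator A B C Ψ := by
  have hform (f : Fock (n + 1)) (g : Fock n) :
      WithLp.toLp 2 (A f + C (Ψ (B f)) - C (Ψ g), -Ψ (B f) + Ψ g) =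
        blockOperator A B C Ψ (WithLp.toLp 2 (f, g)) := by
    rw [blockOperator_apply]
    congr 2 <;> simp only [map_sub] <;> abel
  constructor
  · intro hR
    ext ⟨f, g⟩ : 1
    obtain ⟨af, bf, cf, cg, haf, hbf, hcf, hcg, hRfg⟩ := hR f g
    obtain rfl : A f = af :=
      amp_ext ((h.amp_aInv f).trans ((mem_graph_funH0 _ _ _ _ _).1 haf).symm)
    obtain rfl : B f = bf := amp_ext ((h.isBAInv f).2.trans hbf.2.symm)
    obtain rfl : C _ = cf := amp_ext ((h.isAInvBdag _).trans hcf.symm)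
    obtain rfl : C _ = cg := amp_ext ((h.isAInvBdag _).trans hcg.symm)
    exact hRfg.trans (hform f g)
  · rintro rfl f g
    exact ⟨A f, B f, C (Ψ (B f)), C (Ψ g), (mem_graph_funH0 _ _ _ _ _).2 (h.amp_aInv f),
      h.isBAInv f, h.isAInvBdag _, h.isAInvBdag _, (hform f g).symm⟩

theorem IsFreeBlocks.injective_aInv (hE : E.re < n * m + m)
    (h : IsFreeBlocks m lam n E A B C) : Function.Injective A := by
  intro f f' hff'
  refine amp_ext ?_
  filter_upwards [h.amp_aInv f, h.amp_aInv f', ae_freeEnergy_sub_ne_zero hE] with k hf hf' hk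
  rw [hff', hf'] at hf
  exact (mul_left_cancel₀ (inv_ne_zero hk) hf).symm

theorem annihilate_sub_annihilate (hm : 0 < m) (hE : E.re < n * m + m) (hF : F.re < n * m + m)
    (hA₀ : ∀ f, amp (A₀ f) =ᵐ[nMeasure (n + 1)] fun k => ((freeEnergy m k : ℂ) - F)⁻¹ * amp f k)
    (f : Fock (n + 1)) :
    annihilate m E f - annihilate m F f =ᵐ[nMeasure n] (E - F) • annihilate m E (A₀ f) := by
  filter_upwards [ae_integrable_annihilate hm hE f, ae_integrable_annihilate hm hF f,
    ae_cons (hA₀ f),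
    ae_cons (P := fun k => (freeEnergy m k : ℂ) - E ≠ 0) (ae_freeEnergy_sub_ne_zero hE),
    ae_cons (P := fun k => (freeEnergy m k : ℂ) - F ≠ 0) (ae_freeEnergy_sub_ne_zero hF)]
    with k hintE hintF hA₀k hkE hkF
  rw [Pi.sub_apply, Pi.smul_apply, smul_eq_mul]
  simp only [annihilate]
  rw [← integral_sub hintE hintF, ← integral_const_mul]
  refine integral_congr_ae ?_
  filter_upwards [hA₀k, hkE, hkF] with p hp hpE hpF
  rw [hp]
  field_simp
  ring

section ResolventIdentity

variable (hE : E.re < n * m + m) (hF : F.re < n * m + m)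
  (h : IsFreeBlocks m lam n E A B C) (h₀ : IsFreeBlocks m lam n F A₀ B₀ C₀)

include hE hF h h₀

theorem IsFreeBlocks.aInv_sub : A - A₀ = (E - F) • A ∘L A₀ := by
  rw [sub_eq_iff_eq_add]
  ext f : 1
  refine amp_ext ?_
  filter_upwards [h.amp_aInv f, h₀.amp_aInv f, h.amp_aInv (A₀ f),
    amp_add ((E - F) • A (A₀ f)) (A₀ f), amp_smul (E - F) (A (A₀ f)),
    ae_freeEnergy_sub_ne_zero hE, ae_freeEnergy_sub_ne_zero hF]
    with k hA hA₀ hAA₀ hadd hsmul hkE hkF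
  change amp (A f) k = amp ((E - F) • A (A₀ f) + A₀ f) k
  rw [hadd, Pi.add_apply, hsmul, Pi.smul_apply, hAA₀, hA₀, hA, smul_eq_mul]
  field_simp
  ring

theorem IsFreeBlocks.aInvBdag_sub : C - C₀ = (E - F) • A ∘L C₀ := by
  rw [sub_eq_iff_eq_add]
  ext g : 1
  refine amp_ext ?_
  filter_upwards [h.isAInvBdag g, h₀.isAInvBdag g, h.amp_aInv (C₀ g),
    amp_add ((E - F) • A (C₀ g)) (C₀ g), amp_smul (E - F) (A (C₀ g)),
    ae_freeEnergy_sub_ne_zero hE, ae_freeEnergy_sub_ne_zero hF]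
    with k hC hC₀ hAC₀ hadd hsmul hkE hkF
  change amp (C g) k = amp ((E - F) • A (C₀ g) + C₀ g) k
  rw [hadd, Pi.add_apply, hsmul, Pi.smul_apply, hAC₀, hC₀, hC, smul_eq_mul]
  field_simp
  ring

theorem IsFreeBlocks.bAInv_sub (hm : 0 < m) : B - B₀ = (E - F) • B ∘L A₀ := by
  rw [sub_eq_iff_eq_add]
  ext f : 1
  refine amp_ext ?_
  filter_upwards [(h.isBAInv f).2, (h₀.isBAInv f).2, (h.isBAInv (A₀ f)).2,
    amp_add ((E - F) • B (A₀ f)) (B₀ f), amp_smul (E - F) (B (A₀ f)),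
    annihilate_sub_annihilate hm hE hF h₀.amp_aInv f] with k hB hB₀ hBA₀ hadd hsmul hann
  change amp (B f) k = amp ((E - F) • B (A₀ f) + B₀ f) k
  rw [hadd, Pi.add_apply, hsmul, Pi.smul_apply, hB, hB₀, hBA₀, smul_eq_mul]
  simp only [Pi.sub_apply, Pi.smul_apply, smul_eq_mul, annihilate] at hann
  linear_combination (lam : ℂ) * ((√(n + 1) : ℝ) : ℂ) * hann

theorem IsFreeBlocks.principalInverse_sub (hm : 0 < m) (hmu : mu < m)
    (hΨ : HasBoundedInverse (principalOp m mu lam n E) Ψ)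
    (hΨ₀ : HasBoundedInverse (principalOp m mu lam n F) Ψ₀) :
    Ψ - Ψ₀ = (E - F) • Ψ ∘L (Ψ₀ + B ∘L C₀ ∘L Ψ₀) := by
  ext g : 1
  have hmem := mem_graph_principalOp_of_mem hm hmu hE hF (h₀.isAInvBdag (Ψ₀ g))
    (h.isBAInv (C₀ (Ψ₀ g))) ((hΨ₀ (Ψ₀ g) g).2 rfl)
  rw [hΨ, map_sub, map_smul, sub_eq_iff_eq_add] at hmem
  exact sub_eq_of_eq_add' hmem

theorem IsFreeBlocks.blockOperator_sub (hm : 0 < m) (hmu : mu < m)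
    (hΨ : HasBoundedInverse (principalOp m mu lam n E) Ψ)
    (hΨ₀ : HasBoundedInverse (principalOp m mu lam n F) Ψ₀) :
    blockOperator A B C Ψ - blockOperator A₀ B₀ C₀ Ψ₀ =
      (E - F) • (blockOperator A B C Ψ * blockOperator A₀ B₀ C₀ Ψ₀) :=
  LightFrontLee.blockOperator_sub (h.aInv_sub hE hF h₀) (h.bAInv_sub hE hF h₀ hm)
    (h.aInvBdag_sub hE hF h₀) (h.principalInverse_sub hE hF h₀ hm hmu hΨ hΨ₀)

end ResolventIdentity

end BlockResolvent

/-! ### Nontriviality of the sectors -/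

section Nontrivial

theorem momentumMeasure_ne_zero : momentumMeasure ≠ 0 := by
  have hopen : IsOpen {k : ℝ × ℝ | 0 < k.1} := isOpen_lt continuous_const continuous_fst
  have hac : volume.restrict {k : ℝ × ℝ | 0 < k.1} ≪ momentumMeasure := by
    refine withDensity_absolutelyContinuous' (by fun_prop) ?_
    filter_upwards [ae_restrict_mem hopen.measurableSet] with k (hk : 0 < k.1)
    exact (ENNReal.ofReal_pos.2 (by positivity)).ne'
  intro h
  rw [h, Measure.absolutelyContinuous_zero_iff, Measure.restrict_eq_zero] at hac
  exact (hopen.measure_pos volume ⟨(1, 0), by simp⟩).ne' hac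

theorem comp_perm_mem_univ_pi_iff {ι α : Type*} {t : Set α} (σ : Equiv.Perm ι) (k : ι → α) :
    k ∘ σ ∈ Set.univ.pi (fun _ => t) ↔ k ∈ Set.univ.pi fun _ => t := by
  simp only [Set.mem_univ_pi, Function.comp_apply]
  exact σ.forall_congr_left.trans (by simp only [Equiv.apply_symm_apply])

theorem exists_amp_ae_eq_indicator_pi (n : ℕ) {t : Set (ℝ × ℝ)} (ht : MeasurableSet t)
    (htop : momentumMeasure t ≠ ⊤) :
    ∃ χ : Fock n, amp χ =ᵐ[nMeasure n] (Set.univ.pi fun _ => t).indicator 1 := by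
  have hfin : nMeasure n (Set.univ.pi fun _ => t) ≠ ⊤ := by
    rw [nMeasure, Measure.pi_pi]
    exact ENNReal.prod_ne_top fun _ _ => htop
  refine exists_amp_ae_eq
    (memLp_indicator_const 2 (MeasurableSet.univ_pi fun _ => ht) (1 : ℂ) (Or.inr hfin))
    fun σ => ae_of_all _ fun k => ?_
  exact Set.indicator_const_eq_indicator_const (comp_perm_mem_univ_pi_iff σ k)

instance nontrivial_fock (n : ℕ) : Nontrivial (Fock n) := by
  obtain ⟨t, ht, -, ht₀, htop⟩ := Measure.exists_subset_measure_lt_top MeasurableSet.univ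
    (pos_iff_ne_zero.2 (Measure.measure_univ_ne_zero.2 momentumMeasure_ne_zero))
  obtain ⟨χ, hχ⟩ := exists_amp_ae_eq_indicator_pi n ht htop.ne
  refine ⟨χ, 0, ?_⟩
  rintro rfl
  have hnull : nMeasure n (Set.univ.pi fun _ => t) = 0 := by
    have h := hχ.symm.trans (amp_zero n)
    rwa [Set.indicator_ae_eq_zero, Pi.one_def, Function.support_const one_ne_zero,
      Set.inter_univ] at h
  rw [nMeasure, Measure.pi_pi, Finset.prod_eq_zero_iff] at hnull
  obtain ⟨-, -, ht'⟩ := hnull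
  exact ht₀.ne' ht'

end Nontrivial

/-! ### The Hamiltonian -/

section Hamiltonian

variable {m mu lam : ℝ} {n : ℕ}

theorem exists_isFreeBlocks_adjoint (hm : 0 < m) (lam : ℝ) {E : ℝ} (hE : E < n * m + m) :
    ∃ A B, IsFreeBlocks m lam n E A B B.adjoint ∧ IsSelfAdjoint A := by
  obtain ⟨A, B, C, h⟩ := exists_isFreeBlocks (E := E) hm lam hE
  have hB : ∀ f, IsBAInv m lam n ((starRingEnd ℂ) E) f (B f) :=
    (Complex.conj_ofReal E).symm ▸ h.isBAInv
  exact ⟨A, B, ⟨h.amp_aInv, h.isBAInv, isAInvBdag_adjoint hm hE hB⟩,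
    isSelfAdjoint_of_amp_eq_mul (s := fun h => ((h : ℂ) - E)⁻¹) h.amp_aInv fun h _ => by
      rw [map_inv₀, map_sub, Complex.conj_ofReal, Complex.conj_ofReal]⟩

theorem exists_isHamiltonian (hm : 0 < m) (hmu : mu < m) (lam : ℝ) (n : ℕ) :
    ∃ H : Sector n →ₗ.[ℂ] Sector n, IsHamiltonian m mu lam n H ∧
      (∀ H', IsHamiltonian m mu lam n H' → H' = H) ∧ (realSpectrum H).Nonempty := by
  obtain ⟨E₀, hE₀⟩ := exists_lt (m * ((n : ℝ) - 1) + mu - lam ^ 2 * n / (4 * Real.pi))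
  have hcoupling : 0 ≤ lam ^ 2 * n / (4 * Real.pi) := by positivity
  have hthr : (E₀ : ℂ).re < n * m + mu := by
    rw [Complex.ofReal_re]
    linarith
  have hthr' : (E₀ : ℂ).re < n * m + m := by linarith
  obtain ⟨-, Ψ₀, hΨ₀, hΨ₀sa⟩ := exists_relativePotential_and_inverse hm hmu hE₀
  obtain ⟨A₀, B₀, h₀, hA₀⟩ := exists_isFreeBlocks_adjoint (E := E₀) hm lam hthr'
  have hinj := blockOperator_injective (B := B₀) (C := B₀.adjoint)
    (h₀.injective_aInv hthr') hΨ₀.injective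
  have hsa := isSelfAdjoint_blockOperator (B := B₀) hA₀ hΨ₀sa
  have hres := hasBoundedInverse_ofResolvent hinj (E₀ : ℂ)
  refine ⟨ofResolvent _ E₀, ⟨isSelfAdjoint_ofResolvent hinj hsa E₀, ?_⟩, ?_,
    realSpectrum_nonempty hres hsa⟩
  · intro E hE Ψ hΨ
    have hE' : E.re < n * m + m := by linarith
    obtain ⟨A, B, C, h⟩ := exists_isFreeBlocks hm lam hE'
    refine ⟨blockOperator A B C Ψ, (h.isBlockResolvent_iff _).2 rfl,
      hres.of_resolvent_identity (h.blockOperator_sub hE' hthr' h₀ hm hmu hΨ hΨ₀)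
        (h₀.blockOperator_sub hthr' hE' h hm hmu hΨ₀ hΨ)⟩
  · intro H' hH'
    obtain ⟨R, hR, hR'⟩ := hH'.resolvent E₀ hthr Ψ₀ hΨ₀
    exact eq_of_hasBoundedInverse_shift ((h₀.isBlockResolvent_iff R).1 hR ▸ hR') hres

theorem IsHamiltonian.le_of_mem_realSpectrum (hm : 0 < m) (hmu : mu < m)
    {H : Sector n →ₗ.[ℂ] Sector n} (hH : IsHamiltonian m mu lam n H) {E : ℝ}
    (hE : E ∈ realSpectrum H) :
    m * ((n : ℝ) - 1) + mu - lam ^ 2 * n / (4 * Real.pi) ≤ E := by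
  by_contra! hlt
  have hcoupling : 0 ≤ lam ^ 2 * n / (4 * Real.pi) := by positivity
  obtain ⟨-, Ψ, hΨ, -⟩ := exists_relativePotential_and_inverse hm hmu hlt
  obtain ⟨R, -, hR⟩ := hH.resolvent E (by rw [Complex.ofReal_re]; linarith) Ψ hΨ
  exact hE ⟨R, hR⟩

theorem coupling_le (lam : ℝ) (n : ℕ) :
    lam ^ 2 * n / (4 * Real.pi) ≤ lam ^ 2 * Real.pi * n / 2 := by
  have hpi : 1 / (4 * Real.pi) ≤ Real.pi / 2 := by
    rw [div_le_div_iff₀ (by positivity) two_pos]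
    nlinarith [Real.pi_gt_three]
  calc lam ^ 2 * n / (4 * Real.pi) = lam ^ 2 * n * (1 / (4 * Real.pi)) := by ring
    _ ≤ lam ^ 2 * n * (Real.pi / 2) := by gcongr
    _ = lam ^ 2 * Real.pi * n / 2 := by ring

end Hamiltonian

end LightFrontLee

end

theorem mainTheorem5_general (m mu lam : ℝ) (hm : 0 < m) (hmu : mu < m) (n : ℕ) :
    (∀ E : ℝ, E < m * ((n : ℝ) - 1) + mu - lam ^ 2 * n / (4 * Real.pi) →
      (∃ T : LightFrontLee.Fock n →L[ℂ] LightFrontLee.Fock n,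
        LightFrontLee.relativePotential m mu lam n E =
          (T : LightFrontLee.Fock n →ₗ[ℂ] LightFrontLee.Fock n).toPMap ⊤ ∧ ‖T‖ < 1) ∧
      ∃ Φinv : LightFrontLee.Fock n →L[ℂ] LightFrontLee.Fock n,
        LightFrontLee.HasBoundedInverse (LightFrontLee.principalOp m mu lam n E) Φinv) ∧
    ∃ H : LightFrontLee.Sector n →ₗ.[ℂ] LightFrontLee.Sector n,
      LightFrontLee.IsHamiltonian m mu lam n H ∧
      (∀ H' : LightFrontLee.Sector n →ₗ.[ℂ] LightFrontLee.Sector n,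
        LightFrontLee.IsHamiltonian m mu lam n H' → H' = H) ∧
      (LightFrontLee.realSpectrum H).Nonempty ∧
      BddBelow (LightFrontLee.realSpectrum H) ∧
      m * ((n : ℝ) - 1) + mu - lam ^ 2 * n / (4 * Real.pi) ≤
        LightFrontLee.groundStateEnergy H := by
  refine ⟨fun E hE => ?_, ?_⟩
  · obtain ⟨hT, Φinv, hΦ, -⟩ := LightFrontLee.exists_relativePotential_and_inverse hm hmu hE
    exact ⟨hT, Φinv, hΦ⟩
  · obtain ⟨H, hH, huniq, hne⟩ := LightFrontLee.exists_isHamiltonian hm hmu lam n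
    have hbound := fun E (hE : E ∈ LightFrontLee.realSpectrum H) =>
      hH.le_of_mem_realSpectrum hm hmu hE
    exact ⟨H, hH, huniq, hne, ⟨_, hbound⟩, le_csInf hne hbound⟩

theorem mainTheorem5 (m mu lam : ℝ) (hm : 0 < m) (hmu : mu < m) (n : ℕ) :
    (∀ E : ℝ, E < m * ((n : ℝ) - 1) + mu →
      lam ^ 2 * Real.pi * n / (2 * (m * ((n : ℝ) - 1) + mu - E)) < 1 →
        (∃ T : LightFrontLee.Fock n →L[ℂ] LightFrontLee.Fock n,
          LightFrontLee.relativePotential m mu lam n E =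
            (T : LightFrontLee.Fock n →ₗ[ℂ] LightFrontLee.Fock n).toPMap ⊤ ∧ ‖T‖ < 1) ∧
        (∃ Φinv : LightFrontLee.Fock n →L[ℂ] LightFrontLee.Fock n,
          LightFrontLee.HasBoundedInverse
            (LightFrontLee.principalOp m mu lam n E) Φinv)) ∧
    ∃ H : LightFrontLee.Sector n →ₗ.[ℂ] LightFrontLee.Sector n,
      LightFrontLee.IsHamiltonian m mu lam n H ∧
      (∀ H' : LightFrontLee.Sector n →ₗ.[ℂ] LightFrontLee.Sector n,
        LightFrontLee.IsHamiltonian m mu lam n H' → H' = H) ∧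
      (LightFrontLee.realSpectrum H).Nonempty ∧
      BddBelow (LightFrontLee.realSpectrum H) ∧
      m * ((n : ℝ) - 1) + mu - lam ^ 2 * Real.pi * n / 2 ≤
        LightFrontLee.groundStateEnergy H := by
  obtain ⟨hΦ, H, hH, huniq, hne, hbdd, hle⟩ := mainTheorem5_general m mu lam hm hmu n
  have hcoupling := LightFrontLee.coupling_le lam n
  refine ⟨fun E hE hratio => hΦ E ?_, H, hH, huniq, hne, hbdd, by linarith⟩
  rw [div_lt_one (by linarith)] at hratio
  linarith
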